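/- Let $\epsilon\in\{+1,-1\}$ (the two Weyl quantum walks), and let wave-vectors be rescaled by $\sqrt3$. The Brillouin zone of the body-centered cubic lattice is the rhombic dodecahedron $\{k\in\mathbb R^3:\ |k_a|+|k_b|\le\pi \text{ for } a\ne b\}$ with opposite faces identified, i.e. the torus $\mathsf B=\mathbb R^3/\Lambda$, $\Lambda=\{\pi(a,b,c): a,b,c\in\mathbb Z,\ a+b+c \text{ even}\}$. With $c_\alpha=\cos k_\alpha$, $s_\alpha=\sin k_\alpha$, put on $\mathsf B$ $$\lambda=c_xc_yc_z-\epsilon\, s_xs_ys_z,\qquad n=\begin{pmatrix}s_xc_yc_z+\epsilon\, c_xs_ys_z\\ c_xs_yc_z-\epsilon\, s_xc_ys_z\\ c_xc_ys_z+\epsilon\, s_xs_yc_z\end{pmatrix}.$$ Let $\mathsf B'_0,\mathsf B'_1,\mathsf B'_2,\mathsf B'_3\subset\mathsf B$ be the sets where $(\lambda,\cos 2k_y)$ has the signs $(+,+),(-,+),(+,-),(-,-)$ respectively. Let $\mathsf U\subset\mathbb R^3$ be the open unit ball, $\mathsf H=\{m\in\mathsf U:\ m_x=\pm m_z,\ 2m_x^2+2m_y^2\ge1\}$,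 let $n^{(i)}$ be the restriction of $n$ to $\mathsf B'_i$, $\mathsf B_i=(n^{(i)})^{-1}(\mathsf U\setminus\mathsf H)$, and $$\Sigma_i=\{(\omega,k):\ k\in\mathsf B_i,\ |\omega|\le\tfrac\pi2,\ \sin^2\omega-|n(k)|^2=0\},\qquad \Gamma_0=\{p\in\mathbb R^4:\ p_0^2-|\mathbf p|^2=0\}.$$ For $m\in\mathsf U\setminus\mathsf H$ with $r=|m|$ let $$g(m)=1+r\int_0^r\Big(\frac1{h_{\mathsf U}(s\,m/r)}+\frac1{h_{\mathsf E}(s\,m/r)}\Big)ds\quad (g(0)=1),$$ $$h_{\mathsf U}(m)=1-|m|^2,\qquad h_{\mathsf E}(m)=(m_x^2-m_z^2)^2+\big(\tfrac12-m_x^2-m_y^2\big)^2 .$$ Let $\mathcal N(\omega,m)=g(m)(\sin\omega,m)$, $\mathcal P^{(i)}(\omega,k)=(\omega,n^{(i)}(k))$ and $\mathcal D^{(i)}=\mathcal N\circ\mathcal P^{(i)}$ on $\Sigma_i$. A map between subsets of manifolds is called analytic if near each point it is the restriction of an analytic map defined on an open neighbourhood of the point in the ambient manifold; an analytic diffeomorphism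 is an analytic bijection with analytic inverse. Then, for each $i$: 1. $\mathcal D^{(i)}$ is an analytic diffeomorphism from $\Sigma_i$ onto $\Gamma_0$. 2. The Jacobian matrices of $\mathcal N$ and of $\mathcal D^{(0)}$ (as maps of four variables) at the origin are the identity. More generally, let $k_0=0$, $k_1=(\pi,0,0)$, $k_2=-\epsilon\frac\pi2(1,1,1)$, $k_3=\epsilon\frac\pi2(1,1,1)$. Then $(0,k_i)\in\Sigma_i$, $\mathcal D^{(i)}(0,k_i)=0$, and the Jacobian matrix of $\mathcal D^{(i)}$ at $(0,k_i)$ is $J_i=\mathrm{diag}(1,R_i)$ with $R_0=I$, $R_1=-I$, $R_2=\mathrm{diag}(1,-1,1)$, $R_3=\mathrm{diag}(-1,1,-1)$. 3. The maps $\mathcal L^{(i)}_L=(\mathcal D^{(i)})^{-1}\circ L\circ\mathcal D^{(i)}$, for $L$ in the Lorentz group $O(1,3)$, are well defined analytic diffeomorphisms of $\Sigma_i$, and $L\mapsto\mathcal L^{(i)}_L$ is a homomorphism from $O(1,3)$ to the group of permutations of $\Sigma_i$. They reduce to the usual linear representation at small wave-vector: near $(0,k_i)$ the map $\mathcal L^{(i)}_L$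 is the restriction of an analytic map that fixes $(0,k_i)$ and whose differential there is $J_i^{-1}LJ_i$ (which is $L$ for $i=0$). 4. The set of $k$ in the Brillouin zone that lie in none of the $\mathsf B_i$ has Lebesgue measure zero. -/

import Mathlib

open Set Filter Topology MeasureTheory

noncomputable section

namespace WeylWalk

/-- Three-dimensional Euclidean space; the coordinates `0, 1, 2` are `x, y, z`. -/
abbrev E3 : Type := EuclideanSpace ℝ (Fin 3)

/-- Energy-momentum space: pairs `(ω, k)`, respectively `(p₀, p)`. -/
abbrev E4 : Type := ℝ × E3

/-! ### The Brillouin zone -/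

/-- The reciprocal lattice of the body centered cubic lattice (wave-vectors rescaled by `√3`):
`π (a, b, c)` with integers `a, b, c` and `a + b + c` even. -/
def recipLattice : AddSubgroup E3 where
  carrier := {v | ∃ z : Fin 3 → ℤ, Even (∑ a, z a) ∧ ∀ a, v a = z a * Real.pi}
  zero_mem' := ⟨0, by simp, by simp⟩
  add_mem' := by
    rintro v w ⟨z, hz, hv⟩ ⟨z', hz', hw⟩
    refine ⟨z + z', ?_, fun a => ?_⟩
    · simpa [Finset.sum_add_distrib] using hz.add hz'
    · simp [hv a, hw a]; ring
  neg_mem' := by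
    rintro v ⟨z, hz, hv⟩
    refine ⟨-z, ?_, fun a => ?_⟩
    · simpa [Finset.sum_neg_distrib] using hz.neg
    · simp [hv a]

/-- The Brillouin zone as a compact manifold: the rhombic dodecahedron `firstZone` with its
opposite faces identified, i.e. wave-vectors modulo the reciprocal lattice. -/
abbrev Brillouin : Type := E3 ⧸ recipLattice

/-- The rhombic dodecahedron, the Wigner-Seitz cell of `recipLattice`. -/
def firstZone : Set E3 := {k | ∀ a b : Fin 3, a ≠ b → |k a| + |k b| ≤ Real.pi}

/-- The class of a wave-vector in the Brillouin zone. -/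
def toBrillouin (k : E3) : Brillouin := (k : E3 ⧸ recipLattice)

/-- The covering map `(ω, k) ↦ (ω, [k])`. -/
def covProj (x : E4) : ℝ × Brillouin := (x.1, toBrillouin x.2)

/-! ### The two Weyl walks (`ε = ±1`) -/

/-- The scalar part `λ^±` of the walk `A^±_k = λ^±(k) I - i n^±(k)·σ^±`. -/
def lam (ε : ℤˣ) (k : E3) : ℝ :=
  Real.cos (k 0) * Real.cos (k 1) * Real.cos (k 2)
    - ((ε : ℤ) : ℝ) * (Real.sin (k 0) * Real.sin (k 1) * Real.sin (k 2))

/-- The vector `n^±(k)` of the walk `A^±_k = λ^±(k) I - i n^±(k)·σ^±`. -/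
def nvec (ε : ℤˣ) (k : E3) : E3 :=
  !₂[Real.sin (k 0) * Real.cos (k 1) * Real.cos (k 2)
      + ((ε : ℤ) : ℝ) * (Real.cos (k 0) * Real.sin (k 1) * Real.sin (k 2)),
    Real.cos (k 0) * Real.sin (k 1) * Real.cos (k 2)
      - ((ε : ℤ) : ℝ) * (Real.sin (k 0) * Real.cos (k 1) * Real.sin (k 2)),
    Real.cos (k 0) * Real.cos (k 1) * Real.sin (k 2)
      + ((ε : ℤ) : ℝ) * (Real.sin (k 0) * Real.sin (k 1) * Real.cos (k 2))]

theorem exists_signs {k l : E3} (h : -k + l ∈ recipLattice) :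
    ∃ e : Fin 3 → ℝ, e 0 * e 1 * e 2 = 1 ∧
      ∀ a, Real.sin (l a) = e a * Real.sin (k a) ∧ Real.cos (l a) = e a * Real.cos (k a) := by
  obtain ⟨z, hz, hv⟩ := h
  refine ⟨fun a => (-1 : ℝ) ^ z a, ?_, fun a => ?_⟩
  · have h0 : (-1 : ℝ) ≠ 0 := by norm_num
    rw [← zpow_add₀ h0, ← zpow_add₀ h0]
    rw [Fin.sum_univ_three] at hz
    exact hz.neg_one_zpow
  · have hl : l a = k a + z a * Real.pi := by
      have := hv a
      simp at this
      linarith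
    rw [hl, Real.sin_add_int_mul_pi, Real.cos_add_int_mul_pi]
    exact ⟨rfl, rfl⟩

theorem lam_periodic (ε : ℤˣ) {k l : E3} (h : -k + l ∈ recipLattice) : lam ε k = lam ε l := by
  obtain ⟨e, he, hs⟩ := exists_signs h
  simp only [lam, (hs 0).1, (hs 0).2, (hs 1).1, (hs 1).2, (hs 2).1, (hs 2).2]
  linear_combination (-(Real.cos (k 0) * Real.cos (k 1) * Real.cos (k 2)
    - ((ε : ℤ) : ℝ) * (Real.sin (k 0) * Real.sin (k 1) * Real.sin (k 2)))) * he

theorem nvec_periodic (ε : ℤˣ) {k l : E3} (h : -k + l ∈ recipLattice) :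
    nvec ε k = nvec ε l := by
  obtain ⟨e, he, hs⟩ := exists_signs h
  ext a
  fin_cases a
  · simp only [nvec, (hs 0).1, (hs 0).2, (hs 1).1, (hs 1).2, (hs 2).1, (hs 2).2]
    simp
    linear_combination (-(Real.sin (k 0) * Real.cos (k 1) * Real.cos (k 2)
      + ((ε : ℤ) : ℝ) * (Real.cos (k 0) * Real.sin (k 1) * Real.sin (k 2)))) * he
  · simp only [nvec, (hs 0).1, (hs 0).2, (hs 1).1, (hs 1).2, (hs 2).1, (hs 2).2]
    simp
    linear_combination (-(Real.cos (k 0) * Real.sin (k 1) * Real.cos (k 2)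
      - ((ε : ℤ) : ℝ) * (Real.sin (k 0) * Real.cos (k 1) * Real.sin (k 2)))) * he
  · simp only [nvec, (hs 0).1, (hs 0).2, (hs 1).1, (hs 1).2, (hs 2).1, (hs 2).2]
    simp
    linear_combination (-(Real.cos (k 0) * Real.cos (k 1) * Real.sin (k 2)
      + ((ε : ℤ) : ℝ) * (Real.sin (k 0) * Real.sin (k 1) * Real.cos (k 2)))) * he

theorem cos_two_periodic {k l : E3} (h : -k + l ∈ recipLattice) :
    Real.cos (2 * k 1) = Real.cos (2 * l 1) := by
  obtain ⟨z, -, hv⟩ := h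
  have hl : 2 * l 1 = 2 * k 1 + z 1 * (2 * Real.pi) := by
    have := hv 1
    simp at this
    linarith
  rw [hl, Real.cos_add_int_mul_two_pi]

/-- `λ` on the Brillouin zone. -/
def lamB (ε : ℤˣ) (κ : Brillouin) : ℝ :=
  Quotient.liftOn' κ (lam ε) fun _ _ h => lam_periodic ε (QuotientAddGroup.leftRel_apply.1 h)

/-- `n` on the Brillouin zone. -/
def nB (ε : ℤˣ) (κ : Brillouin) : E3 :=
  Quotient.liftOn' κ (nvec ε) fun _ _ h => nvec_periodic ε (QuotientAddGroup.leftRel_apply.1 h)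

/-- `cos (2 k_y)` on the Brillouin zone. -/
def cosB (κ : Brillouin) : ℝ :=
  Quotient.liftOn' κ (fun k : E3 => Real.cos (2 * k 1))
    fun _ _ h => cos_two_periodic (QuotientAddGroup.leftRel_apply.1 h)

/-! ### The four regions -/

/-- The sign of `λ` on the region with index `i`. -/
def lamSign : Fin 4 → ℝ := ![1, -1, 1, -1]

/-- The sign of `cos (2 k_y)` on the region with index `i`. -/
def cosSign : Fin 4 → ℝ := ![1, 1, -1, -1]

/-- The open region `B'_i`, given by the signs of `λ` and of `cos (2 k_y)`. -/
def region' (ε : ℤˣ) (i : Fin 4) : Set Brillouin :=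
  {κ | 0 < lamSign i * lamB ε κ ∧ 0 < cosSign i * cosB κ}

/-- The open unit ball `U`. -/
def ballU : Set E3 := {m | ‖m‖ < 1}

/-- The set `H` to be removed from `U`. -/
def setH : Set E3 :=
  {m | m ∈ ballU ∧ (m 0 = m 2 ∨ m 0 = -m 2) ∧ 1 ≤ 2 * m 0 ^ 2 + 2 * m 1 ^ 2}

/-- The region `B_i`, the preimage of `U ∖ H` under the restriction of `n` to `B'_i`. -/
def region (ε : ℤˣ) (i : Fin 4) : Set Brillouin :=
  {κ | κ ∈ region' ε i ∧ nB ε κ ∈ ballU \ setH}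

/-- The point of `B_i` where `n` vanishes (a representative). -/
def kCenter (ε : ℤˣ) : Fin 4 → E3 :=
  ![0,
    !₂[Real.pi, 0, 0],
    (-(((ε : ℤ) : ℝ) * (Real.pi / 2))) • !₂[1, 1, 1],
    (((ε : ℤ) : ℝ) * (Real.pi / 2)) • !₂[1, 1, 1]]

/-- The set `Σ_i` of the solutions of the dispersion relation with wave-vector in `B_i`. -/
def solutions (ε : ℤˣ) (i : Fin 4) : Set (ℝ × Brillouin) :=
  {x | x.2 ∈ region ε i ∧ |x.1| ≤ Real.pi / 2 ∧ Real.sin x.1 ^ 2 - ‖nB ε x.2‖ ^ 2 = 0}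

/-! ### The deformation -/

/-- The polynomial vanishing on the unit sphere. -/
def hU (m : E3) : ℝ := 1 - ‖m‖ ^ 2

/-- The polynomial vanishing exactly on the two ellipses
`m_x = ± m_z`, `m_x ^ 2 + m_y ^ 2 = 1 / 2`. -/
def hE (m : E3) : ℝ := (m 0 ^ 2 - m 2 ^ 2) ^ 2 + (1 / 2 - (m 0 ^ 2 + m 1 ^ 2)) ^ 2

/-- `g(m) = 1 + r ∫₀^r (1 / h_U + 1 / h_E) ds` along the ray from `0` to `m`, with `r = |m|`. -/
def gfun (m : E3) : ℝ :=
  1 + ‖m‖ * ∫ s in (0 : ℝ)..‖m‖, (1 / hU (s • (‖m‖⁻¹ • m)) + 1 / hE (s • (‖m‖⁻¹ • m)))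

/-- `𝒩(ω, m) = g(m) (sin ω, m)`. -/
def mapN (x : E4) : E4 := gfun x.2 • (Real.sin x.1, x.2)

/-- `𝒫(ω, k) = (ω, n(k))`. -/
def mapP (ε : ℤˣ) (x : ℝ × Brillouin) : E4 := (x.1, nB ε x.2)

/-- `𝒟 = 𝒩 ∘ 𝒫`; the map `𝒟^(i)` is its restriction to `solutions ε i`. -/
def mapD (ε : ℤˣ) (x : ℝ × Brillouin) : E4 := mapN (mapP ε x)

/-! ### Minkowski space and the Lorentz group -/

/-- The Minkowski square `p_μ p^μ`. -/
def minkowskiSq (p : E4) : ℝ := p.1 ^ 2 - ‖p.2‖ ^ 2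

/-- The null mass shell `Γ_0`. -/
def nullShell : Set E4 := {p | minkowskiSq p = 0}

/-- The Lorentz group `O(1,3)`. -/
def LorentzGroup : Subgroup (E4 ≃L[ℝ] E4) where
  carrier := {L | ∀ p, minkowskiSq (L p) = minkowskiSq p}
  one_mem' := fun _ => rfl
  mul_mem' := by
    intro L M hL hM p
    exact (hL (M p)).trans (hM p)
  inv_mem' := by
    intro L hL p
    have h := hL (L⁻¹ p)
    rw [← h]
    congr 1
    exact L.apply_symm_apply p

/-- `𝓛^(i)_L = (𝒟^(i))⁻¹ ∘ L ∘ 𝒟^(i)`, with the inverse of `𝒟` restricted to `Σ_i`. -/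
def mapL (ε : ℤˣ) (i : Fin 4) (L : LorentzGroup) (x : ℝ × Brillouin) : ℝ × Brillouin :=
  Function.invFunOn (mapD ε) (solutions ε i) ((L : E4 ≃L[ℝ] E4) (mapD ε x))

/-- The signs in the differential of `n` at `kCenter ε i`. -/
def reflSign : Fin 4 → Fin 3 → ℝ := ![![1, 1, 1], ![-1, -1, -1], ![1, -1, 1], ![-1, 1, -1]]

/-- The linear involution `(ω, q) ↦ (ω, R_i q)`, with `R_i` the diagonal matrix of the signs
`reflSign i`; it is the identity for `i = 0`. -/
def jac (i : Fin 4) : E4 →L[ℝ] E4 :=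
  (ContinuousLinearMap.id ℝ ℝ).prodMap
    (Matrix.toEuclideanCLM (n := Fin 3) (𝕜 := ℝ) (Matrix.diagonal (reflSign i)))

/-! ### Analytic maps between subsets

`X` and `Y` are manifolds with analytic structure given by local inverses of the coverings
`pX : V → X` and `pY : W → Y` by vector spaces (the identity, or `covProj`). -/

/-- A map on a subset `S` is analytic if near every point of `S` it agrees on `S` with an
analytic map defined on a full neighbourhood of the point. -/
def IsAnalyticMapOn {V W X Y : Type} [NormedAddCommGroup V] [NormedSpace ℝ V]
    [NormedAddCommGroup W] [NormedSpace ℝ W]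
    (pX : V → X) (pY : W → Y) (F : X → Y) (S : Set X) : Prop :=
  ∀ v : V, pX v ∈ S → ∃ Ft : V → W, AnalyticAt ℝ Ft v ∧
    ∀ᶠ u in 𝓝 v, pX u ∈ S → F (pX u) = pY (Ft u)

/-- An analytic diffeomorphism from the subset `S` onto the subset `T`. -/
def IsAnalyticDiffeo {V W X Y : Type} [NormedAddCommGroup V] [NormedSpace ℝ V]
    [NormedAddCommGroup W] [NormedSpace ℝ W]
    (pX : V → X) (pY : W → Y) (F : X → Y) (S : Set X) (T : Set Y) : Prop :=
  BijOn F S T ∧ IsAnalyticMapOn pX pY F S ∧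
    ∃ G : Y → X, InvOn G F S T ∧ IsAnalyticMapOn pY pX G T

end WeylWalk

end

open WeylWalk

noncomputable section

namespace WeylWalk

/-! ### Trigonometric identities for the walk -/

/-! With `e = ε`, the numbers `λ`, `n_x`, `e n_y`, `n_z` are the coordinates of the unit quaternion
`exp(i k_x) exp(e j k_y) exp(k k_z)`, so the `k_a` are half Tait-Bryan angles of a rotation.
Inverting `n` on a region is therefore the recovery of these angles. The unit norm and the sign of
`λ` give `λ` from `n`; the rotation matrix gives `sin 2k_y`, and the sign of `cos 2k_y` gives `cos
2k_y`. Division by this cosine yields the other two doubled angles, so each `k_a` is known modulo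
`π`, and the sign of `λ` fixes the parity that defines the reciprocal lattice
(`toBrillouin_eq_of_nvec_eq`). Inside the open ball, gimbal lock `cos 2k_y = 0` can occur only over
`H`, so every point of `U ∖ H` is attained (`exists_nvec_eq`), and off gimbal lock with `λ ≠ 0` the
differential of `n` is injective (`fderiv_nvec_injective`).

The set `U ∖ H` is open and star-shaped about the origin. A ray in one of the planes `m_x = ± m_z`
ends where `h_E` vanishes, any other ray where `h_U` does. The integral in `g` is increasing along
each ray and diverges logarithmically at its end, so `m ↦ g(m) m` maps each ray bijectively onto a
half-line (`injOn_gfun_smul`, `exists_gfun_smul_eq`). Rescaling the integral to the unit interval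
gives analyticity, also at the origin (`contDiffAt_gfun`).

Since `g > 0`, the map `𝒩` turns the dispersion relation into the null condition. On `Σ_i` one has
`sin² ω = |n|² < 1`, hence `cos ω ≠ 0` and the full differential of `𝒟` is invertible. The analytic
inverse function theorem on the covering space then gives analytic local inverses
(`exists_local_inverse`). The Lorentz group acts by conjugation with this diffeomorphism, and the
linear limit is the chain rule at the centres. The exceptional wave-vectors lie in zero sets of
trigonometric functions, which are null because suitable parallel lines meet them in countable sets.
-/

theorem norm_sq_eq (m : E3) : ‖m‖ ^ 2 = m 0 ^ 2 + m 1 ^ 2 + m 2 ^ 2 := by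
  rw [EuclideanSpace.real_norm_sq_eq, Fin.sum_univ_three]

theorem sign_sq (ε : ℤˣ) : ((ε : ℤ) : ℝ) ^ 2 = 1 := by
  rcases Int.units_eq_one_or ε with h | h <;> simp [h]

theorem nvec_apply_zero (ε : ℤˣ) (k : E3) : nvec ε k 0 =
    Real.sin (k 0) * Real.cos (k 1) * Real.cos (k 2)
      + ((ε : ℤ) : ℝ) * (Real.cos (k 0) * Real.sin (k 1) * Real.sin (k 2)) := rfl

theorem nvec_apply_one (ε : ℤˣ) (k : E3) : nvec ε k 1 =
    Real.cos (k 0) * Real.sin (k 1) * Real.cos (k 2)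
      - ((ε : ℤ) : ℝ) * (Real.sin (k 0) * Real.cos (k 1) * Real.sin (k 2)) := rfl

theorem nvec_apply_two (ε : ℤˣ) (k : E3) : nvec ε k 2 =
    Real.cos (k 0) * Real.cos (k 1) * Real.sin (k 2)
      + ((ε : ℤ) : ℝ) * (Real.sin (k 0) * Real.sin (k 1) * Real.cos (k 2)) := rfl

theorem lam_sq_add_norm_sq (ε : ℤˣ) (k : E3) : lam ε k ^ 2 + ‖nvec ε k‖ ^ 2 = 1 := by
  have he := sign_sq ε
  have h0 := Real.sin_sq_add_cos_sq (k 0)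
  have h1 := Real.sin_sq_add_cos_sq (k 1)
  have h2 := Real.sin_sq_add_cos_sq (k 2)
  rw [norm_sq_eq, nvec_apply_zero, nvec_apply_one, nvec_apply_two, lam]
  grind

/-- This identity and the next four compare, up to sign, entries of the rotation matrix written in
doubled angles and written quadratically in the quaternion coordinates `(λ, n_x, ε n_y, n_z)`. -/
theorem sin_two_mul_one (ε : ℤˣ) (k : E3) : Real.sin (2 * k 1) =
    2 * (nvec ε k 1 * lam ε k + ((ε : ℤ) : ℝ) * nvec ε k 0 * nvec ε k 2) := by
  have he := sign_sq ε
  have h0 := Real.sin_sq_add_cos_sq (k 0)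
  have h2 := Real.sin_sq_add_cos_sq (k 2)
  rw [nvec_apply_zero, nvec_apply_one, nvec_apply_two, lam, Real.sin_two_mul]
  grind

theorem cos_mul_cos_two_mul_zero (ε : ℤˣ) (k : E3) :
    Real.cos (2 * k 1) * Real.cos (2 * k 0) =
      1 - 2 * (nvec ε k 0 ^ 2 + nvec ε k 1 ^ 2) := by
  have he := sign_sq ε
  have h0 := Real.sin_sq_add_cos_sq (k 0)
  have h1 := Real.sin_sq_add_cos_sq (k 1)
  have h2 := Real.sin_sq_add_cos_sq (k 2)
  rw [nvec_apply_zero, nvec_apply_one, Real.cos_two_mul, Real.cos_two_mul]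
  grind

theorem cos_mul_sin_two_mul_zero (ε : ℤˣ) (k : E3) :
    Real.cos (2 * k 1) * Real.sin (2 * k 0) =
      2 * (lam ε k * nvec ε k 0 - ((ε : ℤ) : ℝ) * nvec ε k 1 * nvec ε k 2) := by
  have he := sign_sq ε
  have h0 := Real.sin_sq_add_cos_sq (k 0)
  have h1 := Real.sin_sq_add_cos_sq (k 1)
  have h2 := Real.sin_sq_add_cos_sq (k 2)
  rw [nvec_apply_zero, nvec_apply_one, nvec_apply_two, lam, Real.cos_two_mul, Real.sin_two_mul]
  grind

theorem cos_mul_cos_two_mul_two (ε : ℤˣ) (k : E3) :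
    Real.cos (2 * k 1) * Real.cos (2 * k 2) =
      1 - 2 * (nvec ε k 2 ^ 2 + nvec ε k 1 ^ 2) := by
  have he := sign_sq ε
  have h0 := Real.sin_sq_add_cos_sq (k 0)
  have h1 := Real.sin_sq_add_cos_sq (k 1)
  have h2 := Real.sin_sq_add_cos_sq (k 2)
  rw [nvec_apply_two, nvec_apply_one, Real.cos_two_mul, Real.cos_two_mul]
  grind

theorem cos_mul_sin_two_mul_two (ε : ℤˣ) (k : E3) :
    Real.cos (2 * k 1) * Real.sin (2 * k 2) =
      2 * (lam ε k * nvec ε k 2 - ((ε : ℤ) : ℝ) * nvec ε k 1 * nvec ε k 0) := by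
  have he := sign_sq ε
  have h0 := Real.sin_sq_add_cos_sq (k 0)
  have h1 := Real.sin_sq_add_cos_sq (k 1)
  have h2 := Real.sin_sq_add_cos_sq (k 2)
  rw [nvec_apply_zero, nvec_apply_one, nvec_apply_two, lam, Real.cos_two_mul, Real.sin_two_mul]
  grind

/-! ### Injectivity of `n` on each region -/

theorem lamSign_sq (i : Fin 4) : lamSign i ^ 2 = 1 := by
  fin_cases i <;> simp [lamSign]

theorem cosSign_sq (i : Fin 4) : cosSign i ^ 2 = 1 := by
  fin_cases i <;> simp [cosSign]

/-- Two numbers with the same square and the same strict sign are equal. -/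
theorem eq_of_sq_eq_of_sign {σ x y : ℝ} (h : x ^ 2 = y ^ 2) (hx : 0 < σ * x) (hy : 0 < σ * y) :
    x = y := by
  rcases sq_eq_sq_iff_eq_or_eq_neg.1 h with h | h
  · exact h
  · subst h; linarith

theorem exists_int_mul_pi {x y : ℝ} (hs : Real.sin (2 * x) = Real.sin (2 * y))
    (hc : Real.cos (2 * x) = Real.cos (2 * y)) : ∃ z : ℤ, y - x = z * Real.pi := by
  have h : Real.cos (2 * y - 2 * x) = 1 := by
    rw [Real.cos_sub, hs, hc]
    have := Real.sin_sq_add_cos_sq (2 * y)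
    linarith
  obtain ⟨z, hz⟩ := (Real.cos_eq_one_iff _).1 h
  exact ⟨z, by linarith⟩

theorem mem_region_mk {ε : ℤˣ} {i : Fin 4} {k : E3} : toBrillouin k ∈ region ε i ↔
    (0 < lamSign i * lam ε k ∧ 0 < cosSign i * Real.cos (2 * k 1)) ∧
      nvec ε k ∈ ballU \ setH := Iff.rfl

theorem toBrillouin_surjective : Function.Surjective toBrillouin :=
  QuotientAddGroup.mk_surjective

/-- The two signs of the region remove the two square-root ambiguities, in `λ` and in `cos 2k_y`.
After that all doubled angles agree, which leaves only shifts by multiples of `π`. -/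
theorem toBrillouin_eq_of_nvec_eq {ε : ℤˣ} {i : Fin 4} {k l : E3}
    (hk : 0 < lamSign i * lam ε k ∧ 0 < cosSign i * Real.cos (2 * k 1))
    (hl : 0 < lamSign i * lam ε l ∧ 0 < cosSign i * Real.cos (2 * l 1))
    (h : nvec ε k = nvec ε l) : toBrillouin k = toBrillouin l := by
  have hlam : lam ε k = lam ε l := by
    refine eq_of_sq_eq_of_sign ?_ hk.1 hl.1
    have h1 := lam_sq_add_norm_sq ε k
    have h2 := lam_sq_add_norm_sq ε l
    rw [h] at h1
    linarith
  have hs1 : Real.sin (2 * k 1) = Real.sin (2 * l 1) := by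
    rw [sin_two_mul_one ε, sin_two_mul_one ε, h, hlam]
  have hc1 : Real.cos (2 * k 1) = Real.cos (2 * l 1) := by
    refine eq_of_sq_eq_of_sign ?_ hk.2 hl.2
    rw [Real.cos_sq', Real.cos_sq', hs1]
  have hne : Real.cos (2 * l 1) ≠ 0 := by
    rintro h0
    have := hl.2
    simp [h0] at this
  have aux : ∀ {x y : ℝ}, Real.cos (2 * k 1) * x = Real.cos (2 * l 1) * y → x = y := by
    intro x y hxy
    rw [hc1] at hxy
    exact mul_left_cancel₀ hne hxy
  obtain ⟨z0, hz0⟩ := exists_int_mul_pi (x := k 0) (y := l 0)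
    (aux (by rw [cos_mul_sin_two_mul_zero ε, cos_mul_sin_two_mul_zero ε, h, hlam]))
    (aux (by rw [cos_mul_cos_two_mul_zero ε, cos_mul_cos_two_mul_zero ε, h]))
  obtain ⟨z1, hz1⟩ := exists_int_mul_pi hs1 hc1
  obtain ⟨z2, hz2⟩ := exists_int_mul_pi (x := k 2) (y := l 2)
    (aux (by rw [cos_mul_sin_two_mul_two ε, cos_mul_sin_two_mul_two ε, h, hlam]))
    (aux (by rw [cos_mul_cos_two_mul_two ε, cos_mul_cos_two_mul_two ε, h]))
  refine QuotientAddGroup.eq.2 ⟨![z0, z1, z2], ?_, ?_⟩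
  · have hcs : ∀ {x y : ℝ} {z : ℤ}, y - x = z * Real.pi →
        Real.sin y = (-1) ^ z * Real.sin x ∧ Real.cos y = (-1) ^ z * Real.cos x := by
      intro x y z hz
      rw [show y = x + z * Real.pi by linarith, Real.sin_add_int_mul_pi, Real.cos_add_int_mul_pi]
      exact ⟨rfl, rfl⟩
    -- Each shift by `π` flips the sign of `λ`; as `λ` is nonzero and unchanged, the total number of
    -- shifts is even.
    have hl' : lam ε l = ((-1) ^ z0 * (-1) ^ z1 * (-1) ^ z2) * lam ε k := by
      simp only [lam, (hcs hz0).1, (hcs hz0).2, (hcs hz1).1, (hcs hz1).2, (hcs hz2).1,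
        (hcs hz2).2]
      ring
    have hne' : lam ε l ≠ 0 := by
      rintro h0
      have := hl.1
      simp [h0] at this
    rw [hlam, ← zpow_add₀ (by norm_num), ← zpow_add₀ (by norm_num)] at hl'
    have hone : (-1 : ℝ) ^ (z0 + z1 + z2) = 1 :=
      mul_right_cancel₀ hne' (by rw [one_mul]; exact hl'.symm)
    have : Even (z0 + z1 + z2) := by
      by_contra hodd
      rw [(Int.not_even_iff_odd.1 hodd).neg_one_zpow] at hone
      norm_num at hone
    simpa [Fin.sum_univ_three] using this
  · intro a
    fin_cases a
    · simp only [PiLp.add_apply, PiLp.neg_apply]; simpa using by linarith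
    · simp only [PiLp.add_apply, PiLp.neg_apply]; simpa using by linarith
    · simp only [PiLp.add_apply, PiLp.neg_apply]; simpa using by linarith

/-! ### Surjectivity of `n` onto `U ∖ H` by Tait-Bryan angles -/

theorem exists_angle {x y : ℝ} (h : x ^ 2 + y ^ 2 = 1) :
    ∃ θ : ℝ, Real.cos θ = x ∧ Real.sin θ = y := by
  have hn : ‖(⟨x, y⟩ : ℂ)‖ = 1 := by
    rw [Complex.norm_def, Complex.normSq_mk, Real.sqrt_eq_one]
    linarith
  have hne : (⟨x, y⟩ : ℂ) ≠ 0 := by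
    rintro h0; simp [h0] at hn
  refine ⟨Complex.arg ⟨x, y⟩, ?_, ?_⟩
  · rw [Complex.cos_arg hne, hn]; simp
  · rw [Complex.sin_arg, hn]; simp

/-- The unit vector in the direction of a nonzero vector of the plane. -/
theorem exists_angle_smul {x y : ℝ} (h : 0 < x ^ 2 + y ^ 2) :
    ∃ r θ : ℝ, 0 < r ∧ x = r * Real.cos θ ∧ y = r * Real.sin θ := by
  set r := Real.sqrt (x ^ 2 + y ^ 2) with hr
  have hr0 : 0 < r := Real.sqrt_pos.2 h
  have hr2 : r ^ 2 = x ^ 2 + y ^ 2 := Real.sq_sqrt h.le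
  obtain ⟨θ, hc, hs⟩ := exists_angle (x := x / r) (y := y / r) (by field_simp; linarith)
  refine ⟨r, θ, hr0, ?_, ?_⟩
  · rw [hc]; field_simp
  · rw [hs]; field_simp

/-- Here `x² + y² = l² + z² = 1/2`. Squaring `l x = e y z` gives `(1/2 - z²) x² = (1/2 - x²) z²`,
and the mixed terms cancel. -/
theorem sq_eq_sq_of_gimbal {e l x y z : ℝ} (he : e ^ 2 = 1)
    (hl : l ^ 2 + (x ^ 2 + y ^ 2 + z ^ 2) = 1) (h1 : 1 - 2 * (x ^ 2 + y ^ 2) = 0)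
    (h2 : l * x - e * y * z = 0) : x ^ 2 = z ^ 2 := by
  grind

/-- A unit quaternion `l + x i + e y j + z k` is a product of rotations about the three axes, with
a prescribed sign of the cosine of the second Tait-Bryan angle off the gimbal lock. -/
theorem exists_tait_bryan {e l x y z σ : ℝ} (he : e ^ 2 = 1) (hσ : σ ^ 2 = 1)
    (hl : l ^ 2 + (x ^ 2 + y ^ 2 + z ^ 2) = 1)
    (hC : 0 < (1 - 2 * (x ^ 2 + y ^ 2)) ^ 2 + (2 * (l * x - e * y * z)) ^ 2) :
    ∃ a b c : ℝ,
      Real.cos a * Real.cos b * Real.cos c - e * (Real.sin a * Real.sin b * Real.sin c) = l ∧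
      Real.sin a * Real.cos b * Real.cos c + e * (Real.cos a * Real.sin b * Real.sin c) = x ∧
      Real.cos a * Real.sin b * Real.cos c - e * (Real.sin a * Real.cos b * Real.sin c) = y ∧
      Real.cos a * Real.cos b * Real.sin c + e * (Real.sin a * Real.sin b * Real.cos c) = z ∧
      0 < σ * Real.cos (2 * b) := by
  -- The two components are the expected values of `cos 2b cos 2a` and `cos 2b sin 2a`, so `a` is
  -- here twice the first angle and `r` is to be `|cos 2b|`. The factor `σ` prescribes the sign of
  -- `cos 2b`.
  obtain ⟨r, a, hr, hrc, hrs⟩ := exists_angle_smul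
    (x := σ * (1 - 2 * (x ^ 2 + y ^ 2)))
    (y := σ * (2 * (l * x - e * y * z))) (by
      rw [mul_pow, mul_pow, hσ]; linarith)
  obtain ⟨c0, hc0⟩ : ∃ c0, c0 = Real.cos (a / 2) := ⟨_, rfl⟩
  obtain ⟨s0, hs0⟩ : ∃ s0, s0 = Real.sin (a / 2) := ⟨_, rfl⟩
  have hca : Real.cos a = 2 * c0 ^ 2 - 1 := by
    rw [hc0, ← Real.cos_two_mul]; ring_nf
  have hsa : Real.sin a = 2 * s0 * c0 := by
    rw [hc0, hs0, ← Real.sin_two_mul]; ring_nf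
  have h0 : s0 ^ 2 + c0 ^ 2 = 1 := by
    rw [hc0, hs0]; exact Real.sin_sq_add_cos_sq _
  rw [hca] at hrc
  rw [hsa] at hrs
  clear hca hsa hC
  -- left multiplication by the inverse of the first rotation
  obtain ⟨p0, hp0⟩ : ∃ p0, p0 = c0 * l + s0 * x := ⟨_, rfl⟩
  obtain ⟨p1, hp1⟩ : ∃ p1, p1 = c0 * x - s0 * l := ⟨_, rfl⟩
  obtain ⟨p2, hp2⟩ : ∃ p2, p2 = c0 * (e * y) + s0 * z := ⟨_, rfl⟩
  obtain ⟨p3, hp3⟩ : ∃ p3, p3 = c0 * z - s0 * (e * y) := ⟨_, rfl⟩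
  -- The remaining quaternion `p` should be `exp(e j b) exp(k c)`, with coordinates `(cos b cos c, e
  -- sin b sin c, e sin b cos c, cos b sin c)`. This relation characterizes such products among unit
  -- quaternions.
  have hpp : p0 * p1 = p2 * p3 := by
    have key : 2 * (p0 * p1 - p2 * p3) = (2 * c0 ^ 2 - 1) * (2 * (l * x - e * y * z))
        - (2 * s0 * c0) * (1 - 2 * (x ^ 2 + y ^ 2)) := by
      subst hp0 hp1 hp2 hp3
      linear_combination (-2 * (l * x - e * y * z)) * h0 + 2 * c0 * s0 * y ^ 2 * he
        - 2 * c0 * s0 * hl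
    have k2 : σ * (2 * (p0 * p1 - p2 * p3)) = 0 := by
      rw [key]; linear_combination (2 * c0 ^ 2 - 1) * hrs - (2 * s0 * c0) * hrc
    have : σ ≠ 0 := by rintro h; simp [h] at hσ
    have := (mul_eq_zero.1 k2).resolve_left this
    linarith
  -- The bracket will be `cos 2b`.
  have hpd : σ * (p0 ^ 2 + p3 ^ 2 - p1 ^ 2 - p2 ^ 2) = r := by
    have key : p0 ^ 2 + p3 ^ 2 - p1 ^ 2 - p2 ^ 2 =
        (2 * c0 ^ 2 - 1) * (1 - 2 * (x ^ 2 + y ^ 2))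
        + (2 * s0 * c0) * (2 * (l * x - e * y * z)) := by
      subst hp0 hp1 hp2 hp3
      clear hpp hrc hrs hc0 hs0 hσ hr
      grind
    rw [key]
    have : (2 * c0 ^ 2 - 1) ^ 2 + (2 * s0 * c0) ^ 2 = 1 := by
      linear_combination 4 * c0 ^ 2 * h0
    linear_combination (2 * c0 ^ 2 - 1) * hrc + (2 * s0 * c0) * hrs + r * this
  have hnorm : p0 ^ 2 + p1 ^ 2 + p2 ^ 2 + p3 ^ 2 = 1 := by
    clear hpp hrc hrs hc0 hs0 hσ hpd hr
    subst hp0 hp1 hp2 hp3; grind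
  have hl' : c0 * p0 - s0 * p1 = l := by
    rw [hp0, hp1]; linear_combination l * h0
  have hx' : s0 * p0 + c0 * p1 = x := by
    rw [hp0, hp1]; linear_combination x * h0
  have hy' : e * (c0 * p2 - s0 * p3) = y := by
    rw [hp2, hp3]; linear_combination y * e ^ 2 * h0 + y * he
  have hz' : s0 * p2 + c0 * p3 = z := by
    rw [hp2, hp3]; linear_combination z * h0
  clear hp0 hp1 hp2 hp3 hrc hrs
  -- By `hpp` the plane vectors `(p0, p3)` and `(p2, p1)` are parallel. The angle `c` is their
  -- common direction, read off from whichever is nonzero.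
  obtain ⟨c, hc1, hc2⟩ : ∃ c : ℝ, p1 * Real.cos c = p2 * Real.sin c ∧
      p3 * Real.cos c = p0 * Real.sin c := by
    by_cases hz : 0 < p0 ^ 2 + p3 ^ 2
    · obtain ⟨t, c, ht, h1, h2⟩ := exists_angle_smul hz
      refine ⟨c, mul_left_cancel₀ ht.ne' ?_, by rw [h1, h2]; ring⟩
      linear_combination (-p1) * h1 + p2 * h2 + hpp
    · have h00 : p0 = 0 := by nlinarith [sq_nonneg p0, sq_nonneg p3]
      have h33 : p3 = 0 := by nlinarith [sq_nonneg p0, sq_nonneg p3]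
      obtain ⟨t, c, ht, h1, h2⟩ := exists_angle_smul (x := p2) (y := p1) (by
        rw [h00, h33] at hnorm; linarith)
      exact ⟨c, by rw [h1, h2]; ring, by rw [h00, h33]; ring⟩
  have h2 := Real.sin_sq_add_cos_sq c
  obtain ⟨c2, hc2'⟩ : ∃ c2, c2 = Real.cos c := ⟨_, rfl⟩
  obtain ⟨s2, hs2'⟩ : ∃ s2, s2 = Real.sin c := ⟨_, rfl⟩
  rw [← hc2', ← hs2'] at hc1 hc2 h2
  have e1 : (p0 * c2 + p3 * s2) ^ 2 = p0 ^ 2 + p3 ^ 2 := by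
    clear * - hc2 h2
    grind
  have e2 : (p1 * s2 + p2 * c2) ^ 2 = p1 ^ 2 + p2 ^ 2 := by
    clear * - hc1 h2
    grind
  obtain ⟨b, hb1, hb2⟩ := exists_angle
    (x := p0 * c2 + p3 * s2) (y := e * (p1 * s2 + p2 * c2)) (by
      rw [mul_pow, he, e1, e2]; linarith)
  have f0 : (p0 * c2 + p3 * s2) * c2 = p0 := by linear_combination s2 * hc2 + p0 * h2
  have f3 : (p0 * c2 + p3 * s2) * s2 = p3 := by linear_combination (-c2) * hc2 + p3 * h2
  have f1 : (p1 * s2 + p2 * c2) * s2 = p1 := by linear_combination (-c2) * hc1 + p1 * h2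
  have f2 : (p1 * s2 + p2 * c2) * c2 = p2 := by linear_combination s2 * hc1 + p2 * h2
  refine ⟨a / 2, b, c, ?_, ?_, ?_, ?_, ?_⟩
  · rw [← hc0, ← hs0, ← hc2', ← hs2', hb1, hb2]
    linear_combination c0 * f0 - s0 * f1 + hl' - s0 * s2 * (p1 * s2 + p2 * c2) * he
  · rw [← hc0, ← hs0, ← hc2', ← hs2', hb1, hb2]
    linear_combination s0 * f0 + c0 * f1 + hx' + c0 * s2 * (p1 * s2 + p2 * c2) * he
  · rw [← hc0, ← hs0, ← hc2', ← hs2', hb1, hb2]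
    linear_combination e * c0 * f2 - e * s0 * f3 + hy'
  · rw [← hc0, ← hs0, ← hc2', ← hs2', hb1, hb2]
    linear_combination c0 * f3 + s0 * f2 + hz' + s0 * c2 * (p1 * s2 + p2 * c2) * he
  · have : Real.cos (2 * b) = p0 ^ 2 + p3 ^ 2 - p1 ^ 2 - p2 ^ 2 := by
      rw [Real.cos_two_mul', hb1, hb2, mul_pow, he, e1, e2]; ring
    rw [this, hpd]
    exact hr

/-- Off the two ellipses the Tait-Bryan angles are determined. -/
theorem gimbal_pos (ε : ℤˣ) {m : E3} (hm : m ∈ ballU \ setH) {l : ℝ} (hl : l ^ 2 + ‖m‖ ^ 2 = 1) :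
    0 < (1 - 2 * (m 0 ^ 2 + m 1 ^ 2)) ^ 2
      + (2 * (l * m 0 - ((ε : ℤ) : ℝ) * m 1 * m 2)) ^ 2 := by
  by_contra hcon
  rw [not_lt] at hcon
  have h1 : 1 - 2 * (m 0 ^ 2 + m 1 ^ 2) = 0 :=
    pow_eq_zero_iff two_ne_zero |>.1 (le_antisymm (le_trans (by simpa using sq_nonneg _) hcon)
      (sq_nonneg _))
  have h2 : 2 * (l * m 0 - ((ε : ℤ) : ℝ) * m 1 * m 2) = 0 :=
    pow_eq_zero_iff two_ne_zero |>.1 (le_antisymm (le_trans (by simpa using sq_nonneg _) hcon)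
      (sq_nonneg _))
  rw [norm_sq_eq] at hl
  have h3 : m 0 ^ 2 = m 2 ^ 2 := sq_eq_sq_of_gimbal (sign_sq ε) hl h1 (by linarith)
  exact hm.2 ⟨hm.1, sq_eq_sq_iff_eq_or_eq_neg.1 h3, by linarith⟩

/-- Complete `m` to a unit quaternion by `l = ± √(1 - |m|²)` with the sign of `λ` on the region,
then factor it with the sign of `cos 2k_y` on the region. -/
theorem exists_nvec_eq (ε : ℤˣ) (i : Fin 4) {m : E3} (hm : m ∈ ballU \ setH) :
    ∃ k : E3, toBrillouin k ∈ region ε i ∧ nvec ε k = m := by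
  have hm1 : ‖m‖ ^ 2 < 1 := by
    have : ‖m‖ < 1 := hm.1
    nlinarith [norm_nonneg m]
  obtain ⟨l, hl, hlpos⟩ : ∃ l : ℝ, l ^ 2 + ‖m‖ ^ 2 = 1 ∧ 0 < lamSign i * l := by
    have hp : 0 < Real.sqrt (1 - ‖m‖ ^ 2) := Real.sqrt_pos.2 (by linarith)
    refine ⟨lamSign i * Real.sqrt (1 - ‖m‖ ^ 2), ?_, ?_⟩
    · rw [mul_pow, lamSign_sq, Real.sq_sqrt (by linarith)]; ring
    · rw [← mul_assoc, ← pow_two, lamSign_sq, one_mul]; exact hp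
  have hC := gimbal_pos ε hm hl
  rw [norm_sq_eq] at hl
  obtain ⟨a, b, c, h1, h2, h3, h4, h5⟩ := exists_tait_bryan (sign_sq ε) (cosSign_sq i) hl hC
  have hn : nvec ε !₂[a, b, c] = m := by
    ext j
    fin_cases j
    exacts [h2, h3, h4]
  have hlam : lam ε !₂[a, b, c] = l := h1
  exact ⟨!₂[a, b, c], mem_region_mk.2 ⟨⟨by rwa [hlam], h5⟩, by rwa [hn]⟩, hn⟩

/-! ### The differential of `n` -/

/-- The exponent `⊤` in `WithTop ℕ∞` is the analytic class, here and in all later `ContDiffAt`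
statements. -/
theorem contDiff_nvec (ε : ℤˣ) : ContDiff ℝ ⊤ (nvec ε) := by
  rw [contDiff_euclidean]
  intro j
  fin_cases j
  · change ContDiff ℝ ⊤ (fun k : E3 => Real.sin (k 0) * Real.cos (k 1) * Real.cos (k 2)
      + ((ε : ℤ) : ℝ) * (Real.cos (k 0) * Real.sin (k 1) * Real.sin (k 2)))
    fun_prop
  · change ContDiff ℝ ⊤ (fun k : E3 => Real.cos (k 0) * Real.sin (k 1) * Real.cos (k 2)
      - ((ε : ℤ) : ℝ) * (Real.sin (k 0) * Real.cos (k 1) * Real.sin (k 2)))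
    fun_prop
  · change ContDiff ℝ ⊤ (fun k : E3 => Real.cos (k 0) * Real.cos (k 1) * Real.sin (k 2)
      + ((ε : ℤ) : ℝ) * (Real.sin (k 0) * Real.sin (k 1) * Real.cos (k 2)))
    fun_prop

theorem continuous_lam (ε : ℤˣ) : Continuous (lam ε) := by
  unfold lam
  fun_prop

theorem differentiable_nvec (ε : ℤˣ) : Differentiable ℝ (nvec ε) :=
  (contDiff_nvec ε).differentiable (by simp)

theorem hasDerivAt_nvec_line (ε : ℤˣ) (k v : E3) (j : Fin 3) :
    HasDerivAt (fun t : ℝ => nvec ε (k + t • v) j) (fderiv ℝ (nvec ε) k v j) 0 := by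
  have h1 : HasDerivAt (fun t : ℝ => k + t • v) v 0 := by
    simpa using ((hasDerivAt_id (0 : ℝ)).smul_const v).const_add k
  have h2 : HasFDerivAt (nvec ε) (fderiv ℝ (nvec ε) k) (k + (0 : ℝ) • v) := by
    simpa using (differentiable_nvec ε k).hasFDerivAt
  exact (EuclideanSpace.proj j : E3 →L[ℝ] ℝ).hasFDerivAt.comp_hasDerivAt 0
    (h2.comp_hasDerivAt 0 h1)

theorem hasDerivAt_sin_line (x y : ℝ) :
    HasDerivAt (fun t : ℝ => Real.sin (x + t * y)) (Real.cos x * y) 0 := by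
  have h : HasDerivAt (fun t : ℝ => x + t * y) y 0 := by
    simpa using ((hasDerivAt_id (0 : ℝ)).mul_const y).const_add x
  simpa using h.sin

theorem hasDerivAt_cos_line (x y : ℝ) :
    HasDerivAt (fun t : ℝ => Real.cos (x + t * y)) (-Real.sin x * y) 0 := by
  have h : HasDerivAt (fun t : ℝ => x + t * y) y 0 := by
    simpa using ((hasDerivAt_id (0 : ℝ)).mul_const y).const_add x
  simpa using h.cos

theorem fderiv_nvec_apply_zero (ε : ℤˣ) (k v : E3) : fderiv ℝ (nvec ε) k v 0 =
    v 0 * lam ε k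
    + v 1 * (-(Real.sin (k 0) * Real.sin (k 1) * Real.cos (k 2))
      + ((ε : ℤ) : ℝ) * (Real.cos (k 0) * Real.cos (k 1) * Real.sin (k 2)))
    + v 2 * (-(Real.sin (k 0) * Real.cos (k 1) * Real.sin (k 2))
      + ((ε : ℤ) : ℝ) * (Real.cos (k 0) * Real.sin (k 1) * Real.cos (k 2))) := by
  have hs := fun a => hasDerivAt_sin_line (k a) (v a)
  have hc := fun a => hasDerivAt_cos_line (k a) (v a)
  refine (hasDerivAt_nvec_line ε k v 0).unique
    (((((hs 0).mul (hc 1)).mul (hc 2)).add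
      ((((hc 0).mul (hs 1)).mul (hs 2)).const_mul ((ε : ℤ) : ℝ))).congr_deriv ?_)
  simp [lam]
  ring

theorem fderiv_nvec_apply_one (ε : ℤˣ) (k v : E3) : fderiv ℝ (nvec ε) k v 1 =
    v 0 * (-(Real.sin (k 0) * Real.sin (k 1) * Real.cos (k 2))
      - ((ε : ℤ) : ℝ) * (Real.cos (k 0) * Real.cos (k 1) * Real.sin (k 2)))
    + v 1 * (Real.cos (k 0) * Real.cos (k 1) * Real.cos (k 2)
      + ((ε : ℤ) : ℝ) * (Real.sin (k 0) * Real.sin (k 1) * Real.sin (k 2)))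
    + v 2 * (-(Real.cos (k 0) * Real.sin (k 1) * Real.sin (k 2))
      - ((ε : ℤ) : ℝ) * (Real.sin (k 0) * Real.cos (k 1) * Real.cos (k 2))) := by
  have hs := fun a => hasDerivAt_sin_line (k a) (v a)
  have hc := fun a => hasDerivAt_cos_line (k a) (v a)
  refine (hasDerivAt_nvec_line ε k v 1).unique
    (((((hc 0).mul (hs 1)).mul (hc 2)).sub
      ((((hs 0).mul (hc 1)).mul (hs 2)).const_mul ((ε : ℤ) : ℝ))).congr_deriv ?_)
  simp
  ring

theorem fderiv_nvec_apply_two (ε : ℤˣ) (k v : E3) : fderiv ℝ (nvec ε) k v 2 =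
    v 0 * (-(Real.sin (k 0) * Real.cos (k 1) * Real.sin (k 2))
      + ((ε : ℤ) : ℝ) * (Real.cos (k 0) * Real.sin (k 1) * Real.cos (k 2)))
    + v 1 * (-(Real.cos (k 0) * Real.sin (k 1) * Real.sin (k 2))
      + ((ε : ℤ) : ℝ) * (Real.sin (k 0) * Real.cos (k 1) * Real.cos (k 2)))
    + v 2 * lam ε k := by
  have hs := fun a => hasDerivAt_sin_line (k a) (v a)
  have hc := fun a => hasDerivAt_cos_line (k a) (v a)
  refine (hasDerivAt_nvec_line ε k v 2).unique
    (((((hc 0).mul (hc 1)).mul (hs 2)).add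
      ((((hs 0).mul (hs 1)).mul (hc 2)).const_mul ((ε : ℤ) : ℝ))).congr_deriv ?_)
  simp [lam]
  ring

/-- A variation of the Tait-Bryan angles that does not change the unit quaternion vanishes, off
the gimbal lock. -/
theorem variation_eq_zero {e c0 s0 c1 s1 c2 s2 v0 v1 v2 : ℝ} (he : e ^ 2 = 1)
    (h0 : s0 ^ 2 + c0 ^ 2 = 1) (h1 : s1 ^ 2 + c1 ^ 2 = 1) (h2 : s2 ^ 2 + c2 ^ 2 = 1)
    (hcos : c1 ^ 2 - s1 ^ 2 ≠ 0)
    (y : v0 * (-(s0 * c1 * c2) - e * (c0 * s1 * s2)) + v1 * (-(c0 * s1 * c2) - e * (s0 * c1 * s2))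
      + v2 * (-(c0 * c1 * s2) - e * (s0 * s1 * c2)) = 0)
    (x0 : v0 * (c0 * c1 * c2 - e * (s0 * s1 * s2)) + v1 * (-(s0 * s1 * c2) + e * (c0 * c1 * s2))
      + v2 * (-(s0 * c1 * s2) + e * (c0 * s1 * c2)) = 0)
    (x1 : v0 * (-(s0 * s1 * c2) - e * (c0 * c1 * s2)) + v1 * (c0 * c1 * c2 + e * (s0 * s1 * s2))
      + v2 * (-(c0 * s1 * s2) - e * (s0 * c1 * c2)) = 0)
    (x2 : v0 * (-(s0 * c1 * s2) + e * (c0 * s1 * c2)) + v1 * (-(c0 * s1 * s2) + e * (s0 * c1 * c2))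
      + v2 * (c0 * c1 * c2 - e * (s0 * s1 * s2)) = 0) :
    v0 = 0 ∧ v1 = 0 ∧ v2 = 0 := by
  -- `P0` to `P3`: the variation of the quaternion multiplied on the left by the inverse of the
  -- first factor.
  have P0 : v0 * (-(e * s1 * s2)) + v1 * (-(s1 * c2)) + v2 * (-(c1 * s2)) = 0 := by
    linear_combination c0 * y + s0 * x0
      - (v0 * (-(e * s1 * s2)) + v1 * (-(s1 * c2)) + v2 * (-(c1 * s2))) * h0
  have P1 : v0 * (c1 * c2) + v1 * (e * c1 * s2) + v2 * (e * s1 * c2) = 0 := by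
    linear_combination c0 * x0 - s0 * y
      - (v0 * (c1 * c2) + v1 * (e * c1 * s2) + v2 * (e * s1 * c2)) * h0
  have P2 : v0 * (-(e * c1 * s2)) + v1 * (c1 * c2) + v2 * (-(s1 * s2)) = 0 := by
    linear_combination c0 * x1 + e * s0 * x2
      - (v0 * (-(e * c1 * s2)) + v1 * (c1 * c2) + v2 * (-(s1 * s2))) * h0
      - (c0 * s0 * s1 * c2 * v0 + s0 ^ 2 * c1 * c2 * v1 - s0 ^ 2 * s1 * s2 * v2) * he
  have P3 : v0 * (e * s1 * c2) + v1 * (-(s1 * s2)) + v2 * (c1 * c2) = 0 := by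
    linear_combination c0 * x2 - e * s0 * x1
      - (v0 * (e * s1 * c2) + v1 * (-(s1 * s2)) + v2 * (c1 * c2)) * h0
      - (c0 * s0 * c1 * s2 * v0 - s0 ^ 2 * s1 * s2 * v1 + s0 ^ 2 * c1 * c2 * v2) * he
  -- `r0` to `r3`: multiplication on the right by the inverse of the third factor. What is left
  -- involves only the middle angle; `v1` separates, and the system for `v0`, `v2` has determinant
  -- `c1² - s1²`.
  have r0 : v1 * s1 = 0 := by
    linear_combination (-c2) * P0 - s2 * P3 - v1 * s1 * h2
  have r2 : v1 * c1 = 0 := by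
    linear_combination c2 * P2 + e * s2 * P1 - v1 * c1 * h2
      - (v1 * c1 * s2 ^ 2 + v2 * s1 * c2 * s2) * he
  have r1 : v0 * c1 + e * v2 * s1 = 0 := by
    linear_combination c2 * P1 - e * s2 * P2 - (v0 * c1 + e * v2 * s1) * h2
      - v0 * c1 * s2 ^ 2 * he
  have r3 : e * v0 * s1 + v2 * c1 = 0 := by
    linear_combination c2 * P3 - s2 * P0 - (e * v0 * s1 + v2 * c1) * h2
  refine ⟨(mul_eq_zero.1 ?_).resolve_right hcos, ?_, (mul_eq_zero.1 ?_).resolve_right hcos⟩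
  · linear_combination c1 * r1 - e * s1 * r3 + v0 * s1 ^ 2 * he
  · linear_combination c1 * r2 + s1 * r0 - v1 * h1
  · linear_combination c1 * r3 - e * s1 * r1 + v2 * s1 ^ 2 * he

theorem fderiv_nvec_injective {ε : ℤˣ} {k : E3} (hlam : lam ε k ≠ 0)
    (hcos : Real.cos (2 * k 1) ≠ 0) {v : E3} (hv : fderiv ℝ (nvec ε) k v = 0) : v = 0 := by
  have x0 := fderiv_nvec_apply_zero ε k v
  have x1 := fderiv_nvec_apply_one ε k v
  have x2 := fderiv_nvec_apply_two ε k v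
  rw [hv] at x0 x1 x2
  simp only [PiLp.zero_apply] at x0 x1 x2
  have h0 := Real.sin_sq_add_cos_sq (k 0)
  have h1 := Real.sin_sq_add_cos_sq (k 1)
  have h2 := Real.sin_sq_add_cos_sq (k 2)
  have he := sign_sq ε
  rw [Real.cos_two_mul'] at hcos
  rw [lam] at x0 x2 hlam
  -- The derivative of `λ` along `v`. Differentiating `λ² + |n|² = 1` gives `λ dλ + n · dn = 0`, so
  -- `dn = 0` and `λ ≠ 0` force `dλ = 0`.
  have hy : v 0 * (-(Real.sin (k 0) * Real.cos (k 1) * Real.cos (k 2))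
        - ((ε : ℤ) : ℝ) * (Real.cos (k 0) * Real.sin (k 1) * Real.sin (k 2)))
      + v 1 * (-(Real.cos (k 0) * Real.sin (k 1) * Real.cos (k 2))
        - ((ε : ℤ) : ℝ) * (Real.sin (k 0) * Real.cos (k 1) * Real.sin (k 2)))
      + v 2 * (-(Real.cos (k 0) * Real.cos (k 1) * Real.sin (k 2))
        - ((ε : ℤ) : ℝ) * (Real.sin (k 0) * Real.sin (k 1) * Real.cos (k 2))) = 0 := by
    refine (mul_eq_zero.1 ?_).resolve_right hlam
    have : ∀ {e c0 s0 c1 s1 c2 s2 v0 v1 v2 : ℝ}, e ^ 2 = 1 → s0 ^ 2 + c0 ^ 2 = 1 →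
      s1 ^ 2 + c1 ^ 2 = 1 → s2 ^ 2 + c2 ^ 2 = 1 →
      (v0 * (-(s0 * c1 * c2) - e * (c0 * s1 * s2)) + v1 * (-(c0 * s1 * c2) - e * (s0 * c1 * s2))
        + v2 * (-(c0 * c1 * s2) - e * (s0 * s1 * c2))) * (c0 * c1 * c2 - e * (s0 * s1 * s2))
      + (s0 * c1 * c2 + e * (c0 * s1 * s2)) *
        (v0 * (c0 * c1 * c2 - e * (s0 * s1 * s2)) + v1 * (-(s0 * s1 * c2) + e * (c0 * c1 * s2))
          + v2 * (-(s0 * c1 * s2) + e * (c0 * s1 * c2)))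
      + (c0 * s1 * c2 - e * (s0 * c1 * s2)) *
        (v0 * (-(s0 * s1 * c2) - e * (c0 * c1 * s2)) + v1 * (c0 * c1 * c2 + e * (s0 * s1 * s2))
          + v2 * (-(c0 * s1 * s2) - e * (s0 * c1 * c2)))
      + (c0 * c1 * s2 + e * (s0 * s1 * c2)) *
        (v0 * (-(s0 * c1 * s2) + e * (c0 * s1 * c2)) + v1 * (-(c0 * s1 * s2) + e * (s0 * c1 * c2))
          + v2 * (c0 * c1 * c2 - e * (s0 * s1 * s2))) = 0 := by
      intros
      grind
    have key := this (v0 := v 0) (v1 := v 1) (v2 := v 2) he h0 h1 h2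
    rw [← x0, ← x1, ← x2] at key
    linear_combination key
  obtain ⟨hv0, hv1, hv2⟩ := variation_eq_zero he h0 h1 h2 hcos hy x0.symm x1.symm x2.symm
  ext j
  fin_cases j
  exacts [hv0, hv1, hv2]

/-! ### The centres of the regions -/

theorem sign_pi_half (ε : ℤˣ) : Real.sin (((ε : ℤ) : ℝ) * (Real.pi / 2)) = ((ε : ℤ) : ℝ) ∧
    Real.cos (((ε : ℤ) : ℝ) * (Real.pi / 2)) = 0 := by
  rcases Int.units_eq_one_or ε with h | h <;> simp [h]

theorem kCenter_two_apply (ε : ℤˣ) (a : Fin 3) :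
    kCenter ε 2 a = -(((ε : ℤ) : ℝ) * (Real.pi / 2)) := by
  fin_cases a <;> simp [kCenter]

theorem kCenter_three_apply (ε : ℤˣ) (a : Fin 3) :
    kCenter ε 3 a = ((ε : ℤ) : ℝ) * (Real.pi / 2) := by
  fin_cases a <;> simp [kCenter]

theorem sin_kCenter_two (ε : ℤˣ) (a : Fin 3) : Real.sin (kCenter ε 2 a) = -((ε : ℤ) : ℝ) := by
  rw [kCenter_two_apply, Real.sin_neg, (sign_pi_half ε).1]

theorem cos_kCenter_two (ε : ℤˣ) (a : Fin 3) : Real.cos (kCenter ε 2 a) = 0 := by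
  rw [kCenter_two_apply, Real.cos_neg, (sign_pi_half ε).2]

theorem sin_kCenter_three (ε : ℤˣ) (a : Fin 3) : Real.sin (kCenter ε 3 a) = ((ε : ℤ) : ℝ) := by
  rw [kCenter_three_apply, (sign_pi_half ε).1]

theorem cos_kCenter_three (ε : ℤˣ) (a : Fin 3) : Real.cos (kCenter ε 3 a) = 0 := by
  rw [kCenter_three_apply, (sign_pi_half ε).2]

theorem lam_kCenter (ε : ℤˣ) (i : Fin 4) : lam ε (kCenter ε i) = lamSign i := by
  have he := sign_sq ε
  fin_cases i
  · simp [lam, kCenter, lamSign]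
  · simp [lam, kCenter, lamSign]
  · simp [lam, sin_kCenter_two, cos_kCenter_two, lamSign]
    linear_combination (((ε : ℤ) : ℝ) ^ 2 + 1) * he
  · simp [lam, sin_kCenter_three, cos_kCenter_three, lamSign]
    linear_combination (((ε : ℤ) : ℝ) ^ 2 + 1) * he

theorem cos_two_mul_kCenter (ε : ℤˣ) (i : Fin 4) :
    Real.cos (2 * kCenter ε i 1) = cosSign i := by
  fin_cases i
  · simp [kCenter, cosSign]
  · simp [kCenter, cosSign]
  · simp [Real.cos_two_mul, cos_kCenter_two, cosSign]
  · simp [Real.cos_two_mul, cos_kCenter_three, cosSign]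

theorem nvec_kCenter (ε : ℤˣ) (i : Fin 4) : nvec ε (kCenter ε i) = 0 := by
  have h := lam_sq_add_norm_sq ε (kCenter ε i)
  rw [lam_kCenter, lamSign_sq] at h
  exact norm_eq_zero.1 (pow_eq_zero_iff two_ne_zero |>.1 (by linarith))

theorem zero_mem_ballU_diff_setH : (0 : E3) ∈ ballU \ setH := by
  refine ⟨by simp [ballU], ?_⟩
  rintro ⟨-, -, h⟩
  norm_num at h

theorem kCenter_mem_region (ε : ℤˣ) (i : Fin 4) : toBrillouin (kCenter ε i) ∈ region ε i := by
  refine mem_region_mk.2 ⟨⟨?_, ?_⟩, ?_⟩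
  · rw [lam_kCenter, ← pow_two, lamSign_sq]; exact one_pos
  · rw [cos_two_mul_kCenter, ← pow_two, cosSign_sq]; exact one_pos
  · rw [nvec_kCenter]; exact zero_mem_ballU_diff_setH

theorem fderiv_nvec_kCenter (ε : ℤˣ) (i : Fin 4) : fderiv ℝ (nvec ε) (kCenter ε i) =
    Matrix.toEuclideanCLM (n := Fin 3) (𝕜 := ℝ) (Matrix.diagonal (reflSign i)) := by
  have he := sign_sq ε
  have he3 : ((ε : ℤ) : ℝ) * (((ε : ℤ) : ℝ) * ((ε : ℤ) : ℝ) * ((ε : ℤ) : ℝ)) = 1 := by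
    linear_combination (((ε : ℤ) : ℝ) ^ 2 + 1) * he
  ext v j
  have hR : (Matrix.toEuclideanCLM (n := Fin 3) (𝕜 := ℝ) (Matrix.diagonal (reflSign i)) v) j
      = reflSign i j * v j := by
    rw [Matrix.ofLp_toEuclideanCLM, Matrix.mulVec_diagonal]
  rw [hR]
  have h0 := fderiv_nvec_apply_zero ε (kCenter ε i) v
  have h1 := fderiv_nvec_apply_one ε (kCenter ε i) v
  have h2 := fderiv_nvec_apply_two ε (kCenter ε i) v
  rw [lam_kCenter] at h0 h2
  fin_cases j
  · refine h0.trans ?_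
    fin_cases i
    · simp [kCenter, lamSign, reflSign]
    · simp [kCenter, lamSign, reflSign]
    · simp [sin_kCenter_two, cos_kCenter_two, lamSign, reflSign]
    · simp [sin_kCenter_three, cos_kCenter_three, lamSign, reflSign]
  · refine h1.trans ?_
    fin_cases i
    · simp [kCenter, reflSign]
    · simp [kCenter, reflSign]
    · simp [sin_kCenter_two, cos_kCenter_two, reflSign]
      linear_combination (v 1) * he3
    · simp [sin_kCenter_three, cos_kCenter_three, reflSign]
      linear_combination (v 1) * he3
  · refine h2.trans ?_
    fin_cases i
    · simp [kCenter, lamSign, reflSign]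
    · simp [kCenter, lamSign, reflSign]
    · simp [sin_kCenter_two, cos_kCenter_two, lamSign, reflSign]
    · simp [sin_kCenter_three, cos_kCenter_three, lamSign, reflSign]

/-! ### The domain `U ∖ H` -/

theorem hU_pos {m : E3} (hm : m ∈ ballU) : 0 < hU m := by
  have : ‖m‖ < 1 := hm
  unfold hU
  nlinarith [norm_nonneg m]

theorem hE_nonneg (m : E3) : 0 ≤ hE m := add_nonneg (sq_nonneg _) (sq_nonneg _)

theorem hE_pos {m : E3} (hm : m ∈ ballU \ setH) : 0 < hE m := by
  refine (hE_nonneg m).lt_of_ne fun h => hm.2 ⟨hm.1, ?_, ?_⟩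
  · have : m 0 ^ 2 - m 2 ^ 2 = 0 := pow_eq_zero_iff two_ne_zero |>.1
      ((add_eq_zero_iff_of_nonneg (sq_nonneg _) (sq_nonneg _)).1 h.symm).1
    exact sq_eq_sq_iff_eq_or_eq_neg.1 (by linarith)
  · have : 1 / 2 - (m 0 ^ 2 + m 1 ^ 2) = 0 := pow_eq_zero_iff two_ne_zero |>.1
      ((add_eq_zero_iff_of_nonneg (sq_nonneg _) (sq_nonneg _)).1 h.symm).2
    linarith

/-- Star-shapedness: the planes in `H` are cones, and its quadratic inequality persists under
outward scaling. -/
theorem smul_mem_ballU_diff_setH {m : E3} (hm : m ∈ ballU \ setH) {t : ℝ} (ht : t ∈ Icc (0 : ℝ) 1) :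
    t • m ∈ ballU \ setH := by
  have hm1 : ‖m‖ < 1 := hm.1
  refine ⟨?_, ?_⟩
  · change ‖t • m‖ < 1
    rw [norm_smul, Real.norm_of_nonneg ht.1]
    nlinarith [norm_nonneg m, ht.1, ht.2]
  · rintro ⟨-, h1, h2⟩
    simp only [PiLp.smul_apply, smul_eq_mul] at h1 h2
    have ht0 : t ≠ 0 := by rintro rfl; norm_num at h2
    refine hm.2 ⟨hm.1, h1.imp (mul_left_cancel₀ ht0) fun h => mul_left_cancel₀ ht0 (by linarith), ?_⟩
    have : t ^ 2 ≤ 1 := by nlinarith [ht.1, ht.2]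
    nlinarith [sq_nonneg (m 0), sq_nonneg (m 1)]

theorem isOpen_ballU_diff_setH : IsOpen (ballU \ setH) := by
  have h : ballU \ setH = ballU ∩
      {m : E3 | (m 0 = m 2 ∨ m 0 = -m 2) ∧ 1 ≤ 2 * m 0 ^ 2 + 2 * m 1 ^ 2}ᶜ := by
    ext m
    constructor
    · exact fun h => ⟨h.1, fun h' => h.2 ⟨h.1, h'⟩⟩
    · exact fun h => ⟨h.1, fun h' => h.2 h'.2⟩
  rw [h]
  refine IsOpen.inter (isOpen_lt continuous_norm continuous_const) (isOpen_compl_iff.2 ?_)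
  have h1 : IsClosed {m : E3 | m 0 = m 2} := isClosed_eq (by fun_prop) (by fun_prop)
  have h2 : IsClosed {m : E3 | m 0 = -m 2} := isClosed_eq (by fun_prop) (by fun_prop)
  have h3 : IsClosed {m : E3 | 1 ≤ 2 * m 0 ^ 2 + 2 * m 1 ^ 2} :=
    isClosed_le (by fun_prop) (by fun_prop)
  exact (h1.union h2).inter h3

/-! ### The radial integral -/

/-- The integrand in the definition of `g`. -/
def gdens (m : E3) : ℝ := 1 / hU m + 1 / hE m

theorem gdens_pos {m : E3} (hm : m ∈ ballU \ setH) : 0 < gdens m :=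
  add_pos (one_div_pos.2 (hU_pos hm.1)) (one_div_pos.2 (hE_pos hm))

theorem continuous_hU : Continuous hU := by unfold hU; fun_prop

theorem continuous_hE : Continuous hE := by unfold hE; fun_prop

theorem continuousOn_gdens : ContinuousOn gdens (ballU \ setH) := by
  unfold gdens
  refine ContinuousOn.add ?_ ?_
  · exact continuousOn_const.div continuous_hU.continuousOn fun m hm => (hU_pos hm.1).ne'
  · exact continuousOn_const.div continuous_hE.continuousOn fun m hm => (hE_pos hm).ne'

/-- The substitution `s ↦ ‖m‖ s` removes the unit vector `m / ‖m‖`, and with it the apparent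
singularity of `g` at the origin. -/
theorem gfun_smul (m : E3) {t : ℝ} (ht : 0 ≤ t) :
    gfun (t • m) = 1 + t * ‖m‖ ^ 2 * ∫ s in (0 : ℝ)..t, gdens (s • m) := by
  rcases eq_or_ne m 0 with rfl | hm
  · simp [gfun]
  rcases ht.eq_or_lt with rfl | ht
  · simp [gfun]
  have hm0 : ‖m‖ ≠ 0 := norm_ne_zero_iff.2 hm
  have h1 : ‖t • m‖⁻¹ • t • m = ‖m‖⁻¹ • m := by
    rw [norm_smul, Real.norm_of_nonneg ht.le, smul_smul]
    congr 1
    field_simp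
  have h2 := intervalIntegral.integral_comp_mul_left (a := 0) (b := t)
    (fun s => gdens (s • ‖m‖⁻¹ • m)) hm0
  have h3 : ∀ s : ℝ, (‖m‖ * s) • ‖m‖⁻¹ • m = s • m := by
    intro s
    rw [smul_smul]
    congr 1
    field_simp
  simp only [h3, mul_zero, smul_eq_mul] at h2
  unfold gfun
  rw [h1, h2, norm_smul, Real.norm_of_nonneg ht.le, mul_comm ‖m‖ t]
  simp only [gdens]
  field_simp

theorem gfun_eq (m : E3) : gfun m = 1 + ‖m‖ ^ 2 * ∫ s in (0 : ℝ)..1, gdens (s • m) := by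
  have := gfun_smul m zero_le_one
  rwa [one_smul, one_mul] at this

theorem gfun_zero : gfun 0 = 1 := by simp [gfun]

theorem intervalIntegrable_gdens {m : E3} {t : ℝ} (ht : 0 ≤ t)
    (hm : ∀ s ∈ Icc 0 t, s • m ∈ ballU \ setH) :
    IntervalIntegrable (fun s : ℝ => gdens (s • m)) volume 0 t := by
  refine ContinuousOn.intervalIntegrable ?_
  rw [uIcc_of_le ht]
  exact continuousOn_gdens.comp (by fun_prop) hm

theorem one_le_gfun {m : E3} (hm : m ∈ ballU \ setH) : 1 ≤ gfun m := by
  rw [gfun_eq]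
  have : 0 ≤ ∫ s in (0 : ℝ)..1, gdens (s • m) :=
    intervalIntegral.integral_nonneg zero_le_one fun s hs =>
      (gdens_pos (smul_mem_ballU_diff_setH hm hs)).le
  nlinarith [sq_nonneg ‖m‖, mul_nonneg (sq_nonneg ‖m‖) this]

theorem gfun_smul_le {m : E3} (hm : m ∈ ballU \ setH) {t : ℝ} (ht : t ∈ Icc (0 : ℝ) 1) :
    gfun (t • m) ≤ gfun m := by
  have hint := intervalIntegrable_gdens zero_le_one
    fun s (hs : s ∈ Icc (0 : ℝ) 1) => smul_mem_ballU_diff_setH hm hs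
  rw [gfun_smul m ht.1, gfun_eq m]
  have h0 : 0 ≤ ∫ s in (0 : ℝ)..1, gdens (s • m) :=
    intervalIntegral.integral_nonneg zero_le_one fun s hs =>
      (gdens_pos (smul_mem_ballU_diff_setH hm hs)).le
  have h1 : (∫ s in (0 : ℝ)..t, gdens (s • m)) ≤ ∫ s in (0 : ℝ)..1, gdens (s • m) := by
    refine intervalIntegral.integral_mono_interval le_rfl ht.1 ht.2 ?_ hint
    refine (ae_restrict_iff' measurableSet_Ioc).2 (Eventually.of_forall fun s hs => ?_)
    exact (gdens_pos (smul_mem_ballU_diff_setH hm ⟨hs.1.le, hs.2⟩)).le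
  have h2 : t * (∫ s in (0 : ℝ)..t, gdens (s • m)) ≤ ∫ s in (0 : ℝ)..1, gdens (s • m) :=
    (mul_le_mul_of_nonneg_left h1 ht.1).trans (mul_le_of_le_one_left h0 ht.2)
  nlinarith [mul_le_mul_of_nonneg_left h2 (sq_nonneg ‖m‖)]

/-! ### Analyticity of `g` -/

/-- Integration over the unit interval, as a continuous linear functional. -/
def unitIntegral : C(Icc (0 : ℝ) 1, ℝ) →L[ℝ] ℝ :=
  LinearMap.mkContinuous
    { toFun := fun f => ∫ t in (0 : ℝ)..1, f (projIcc 0 1 zero_le_one t)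
      map_add' := fun f g => by
        simp only [ContinuousMap.add_apply]
        exact intervalIntegral.integral_add
          ((f.continuous.comp continuous_projIcc).intervalIntegrable _ _)
          ((g.continuous.comp continuous_projIcc).intervalIntegrable _ _)
      map_smul' := fun c f => by simp } 1 fun f => by
    have := intervalIntegral.norm_integral_le_of_norm_le_const (a := 0) (b := 1)
      (f := fun t : ℝ => f (projIcc 0 1 zero_le_one t)) fun t _ => f.norm_coe_le_norm _
    simpa using this

theorem unitIntegral_apply (f : C(Icc (0 : ℝ) 1, ℝ)) :
    unitIntegral f = ∫ t in (0 : ℝ)..1, f (projIcc 0 1 zero_le_one t) := rfl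

theorem inverse_continuousMap_apply {K : Type*} [TopologicalSpace K] [CompactSpace K]
    {f : C(K, ℝ)} (hf : IsUnit f) (t : K) : Ring.inverse f t = 1 / f t := by
  have h : f t * Ring.inverse f t = 1 := by
    rw [← ContinuousMap.mul_apply, Ring.mul_inverse_cancel f hf, ContinuousMap.one_apply]
  exact (eq_one_div_of_mul_eq_one_right h)

/-- An integral over the unit interval of the reciprocal of a function depending analytically on a
parameter depends analytically on the parameter, where the function has no zero. -/
theorem contDiffAt_integral_one_div {V : Type*} [NormedAddCommGroup V] [NormedSpace ℝ V]
    {h : V → ℝ → ℝ} {H : V → C(Icc (0 : ℝ) 1, ℝ)} (hHh : ∀ m t, H m t = h m t) {m : V}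
    (hH : ContDiffAt ℝ ⊤ H m) (hne : ∀ t ∈ Icc (0 : ℝ) 1, h m t ≠ 0) :
    ContDiffAt ℝ ⊤ (fun m => ∫ t in (0 : ℝ)..1, 1 / h m t) m := by
  have hu : IsUnit (H m) := ContinuousMap.isUnit_iff_forall_ne_zero _ |>.2 fun t => by
    rw [hHh]; exact hne t t.2
  have h1 : ContDiffAt ℝ ⊤ (fun m => unitIntegral (Ring.inverse (H m))) m := by
    have h2 : ContDiffAt ℝ ⊤ Ring.inverse (H m) := contDiffAt_ringInverse ℝ hu.unit
    have h3 : ContDiffAt ℝ ⊤ (fun m => Ring.inverse (H m)) m := h2.comp m hH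
    exact unitIntegral.contDiff.contDiffAt.comp m h3
  refine h1.congr_of_eventuallyEq ?_
  -- `Ring.inverse` is the pointwise reciprocal only at units; these form an open set in the Banach
  -- algebra of continuous functions.
  filter_upwards [hH.continuousAt.eventually (Units.isOpen.mem_nhds hu)] with m' hm'
  rw [unitIntegral_apply]
  refine intervalIntegral.integral_congr fun t ht => ?_
  rw [uIcc_of_le zero_le_one] at ht
  rw [inverse_continuousMap_apply hm', hHh, projIcc_of_mem zero_le_one ht]

theorem contDiffAt_gfun {m : E3} (hm : m ∈ ballU \ setH) : ContDiffAt ℝ ⊤ gfun m := by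
  -- Both `h_U(t m)` and `h_E(t m)` are polynomials in `t²` with coefficients polynomial in `m`,
  -- hence analytic maps into the function algebra.
  let τ : C(Icc (0 : ℝ) 1, ℝ) := ⟨fun t => (t : ℝ) ^ 2, by fun_prop⟩
  have hU' : ContDiffAt ℝ ⊤ (fun m : E3 => ∫ t in (0 : ℝ)..1, 1 / hU (t • m)) m := by
    refine contDiffAt_integral_one_div (H := fun m => 1 - (‖m‖ ^ 2) • τ) ?_ ?_ ?_
    · intro m t
      simp only [hU, norm_smul, Real.norm_eq_abs, mul_pow, sq_abs]
      simp [τ]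
      ring
    · exact (contDiff_const.sub ((contDiff_norm_sq ℝ).smul contDiff_const)).contDiffAt
    · exact fun t ht => (hU_pos (smul_mem_ballU_diff_setH hm ht).1).ne'
  have hE' : ContDiffAt ℝ ⊤ (fun m : E3 => ∫ t in (0 : ℝ)..1, 1 / hE (t • m)) m := by
    refine contDiffAt_integral_one_div (H := fun m =>
      ((m 0 ^ 2 - m 2 ^ 2) • τ) ^ 2
        + ((1 / 2 : ℝ) • (1 : C(Icc (0 : ℝ) 1, ℝ)) - (m 0 ^ 2 + m 1 ^ 2) • τ) ^ 2) ?_ ?_ ?_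
    · intro m t
      simp [hE, τ]
      ring
    · fun_prop
    · exact fun t ht => (hE_pos (smul_mem_ballU_diff_setH hm ht)).ne'
  have h : ContDiffAt ℝ ⊤ (fun m : E3 => 1 + ‖m‖ ^ 2 *
      ((∫ t in (0 : ℝ)..1, 1 / hU (t • m)) + ∫ t in (0 : ℝ)..1, 1 / hE (t • m))) m :=
    contDiffAt_const.add ((contDiff_norm_sq ℝ).contDiffAt.mul (hU'.add hE'))
  refine h.congr_of_eventuallyEq ?_
  filter_upwards [isOpen_ballU_diff_setH.mem_nhds hm] with m' hm'
  rw [gfun_eq, ← intervalIntegral.integral_add]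
  · rfl
  · refine ContinuousOn.intervalIntegrable ?_
    rw [uIcc_of_le zero_le_one]
    exact continuousOn_const.div (continuous_hU.comp (by fun_prop)).continuousOn
      fun t ht => (hU_pos (smul_mem_ballU_diff_setH hm' ht).1).ne'
  · refine ContinuousOn.intervalIntegrable ?_
    rw [uIcc_of_le zero_le_one]
    exact continuousOn_const.div (continuous_hE.comp (by fun_prop)).continuousOn
      fun t ht => (hE_pos (smul_mem_ballU_diff_setH hm' ht)).ne'

theorem differentiableAt_gfun {m : E3} (hm : m ∈ ballU \ setH) : DifferentiableAt ℝ gfun m :=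
  (contDiffAt_gfun hm).differentiableAt (by simp)

theorem fderiv_gfun_self_nonneg {m : E3} (hm : m ∈ ballU \ setH) : 0 ≤ fderiv ℝ gfun m m := by
  have h1 : HasDerivAt (fun t : ℝ => t • m) m 1 := by
    simpa using (hasDerivAt_id (1 : ℝ)).smul_const m
  have h2 : HasFDerivAt gfun (fderiv ℝ gfun m) ((1 : ℝ) • m) := by
    rw [one_smul]; exact (differentiableAt_gfun hm).hasFDerivAt
  have h3 : HasDerivAt (fun t : ℝ => gfun (t • m)) (fderiv ℝ gfun m m) 1 := by
    have := h2.comp_hasDerivAt 1 h1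
    exact this
  -- Slopes from the left suffice, where `gfun_smul_le` compares `g(t m)` with `g(m)`.
  refine ge_of_tendsto (h3.tendsto_slope.mono_left (nhdsLT_le_nhdsNE 1)) ?_
  filter_upwards [Ioo_mem_nhdsLT (zero_lt_one' ℝ)] with t ht
  rw [slope_def_field, one_smul]
  exact div_nonneg_of_nonpos (sub_nonpos.2 (gfun_smul_le hm ⟨ht.1.le, ht.2.le⟩))
    (by linarith [ht.2])

/-! ### The radial deformation is a bijection from `U ∖ H` onto the whole space -/

/-- If the images agree and `g(m) ≤ g(m')`, then `m'` is a contraction of `m`, so monotonicity along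
rays gives `g(m') ≤ g(m)` as well. -/
theorem injOn_gfun_smul : InjOn (fun m : E3 => gfun m • m) (ballU \ setH) := by
  have key : ∀ {m m' : E3}, m ∈ ballU \ setH → m' ∈ ballU \ setH → gfun m ≤ gfun m' →
      gfun m • m = gfun m' • m' → m = m' := by
    intro m m' hm hm' hle h
    have hg : 0 < gfun m := zero_lt_one.trans_le (one_le_gfun hm)
    have hg' : 0 < gfun m' := zero_lt_one.trans_le (one_le_gfun hm')
    have hc : m' = (gfun m / gfun m') • m := by
      rw [div_eq_inv_mul, ← smul_smul, h, smul_smul, inv_mul_cancel₀ hg'.ne', one_smul]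
    have hle' : gfun m' ≤ gfun m := by
      conv_lhs => rw [hc]
      exact gfun_smul_le hm ⟨div_nonneg hg.le hg'.le, (div_le_one hg').2 hle⟩
    rw [le_antisymm hle hle'] at h
    exact smul_right_injective _ hg'.ne' h
  intro m hm m' hm' h
  rcases le_total (gfun m) (gfun m') with hle | hle
  · exact key hm hm' hle h
  · exact (key hm' hm hle h.symm).symm

/-- Along each ray the integrand of `g` has a pole at the end point of the ray in `U ∖ H`. -/
theorem exists_ray_end {u : E3} (hu : ‖u‖ = 1) : ∃ ρ : ℝ, 0 < ρ ∧
    ∀ s, 0 ≤ s → s < ρ → s • u ∈ ballU \ setH ∧ (1 / 2) * (ρ - s)⁻¹ ≤ gdens (s • u) := by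
  have hu2 : u 0 ^ 2 + u 1 ^ 2 + u 2 ^ 2 = 1 := by rw [← norm_sq_eq, hu]; norm_num
  have hball : ∀ {s : ℝ}, 0 ≤ s → s < 1 → s • u ∈ ballU := by
    intro s h0 h1
    change ‖s • u‖ < 1
    rwa [norm_smul, hu, mul_one, Real.norm_of_nonneg h0]
  by_cases h : u 0 ^ 2 = u 2 ^ 2
  -- The ray lies in a plane of `H` and ends on an ellipse, at `ρ² β = 1/2`. Here `β ≥ 1/2` gives `ρ
  -- ≤ 1`, so the ellipse is met no later than the sphere.
  · set β := u 0 ^ 2 + u 1 ^ 2 with hβ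
    have hβ1 : 1 / 2 ≤ β := by nlinarith [sq_nonneg (u 1)]
    have hβ2 : β ≤ 1 := by nlinarith [sq_nonneg (u 2)]
    have hρpos : 0 < Real.sqrt (1 / (2 * β)) := Real.sqrt_pos.2 (by positivity)
    have hρ2 : Real.sqrt (1 / (2 * β)) ^ 2 = 1 / (2 * β) := Real.sq_sqrt (by positivity)
    set ρ := Real.sqrt (1 / (2 * β))
    have hρβ : ρ ^ 2 * β = 1 / 2 := by rw [hρ2]; field_simp
    have hρ1 : ρ ≤ 1 := by nlinarith
    refine ⟨ρ, hρpos, fun s h0 h1 => ?_⟩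
    have hx : 0 < 1 / 2 - s ^ 2 * β := by nlinarith
    have hmem : s • u ∈ ballU \ setH := by
      refine ⟨hball h0 (h1.trans_le hρ1), ?_⟩
      rintro ⟨-, -, h3⟩
      simp only [PiLp.smul_apply, smul_eq_mul] at h3
      have : 1 ≤ 2 * (s ^ 2 * β) := by rw [hβ]; linarith
      linarith
    refine ⟨hmem, ?_⟩
    have hhE : hE (s • u) = (1 / 2 - s ^ 2 * β) ^ 2 := by
      simp only [hE, PiLp.smul_apply, smul_eq_mul, hβ]
      linear_combination s ^ 4 * (u 0 ^ 2 - u 2 ^ 2) * h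
    -- `h_E` is the square of a number that is at most `1/2` and at most `2 (ρ - s)`.
    have hle : hE (s • u) ≤ ρ - s := by
      have hx2 : 1 / 2 - s ^ 2 * β ≤ 2 * (ρ - s) := by
        have : 1 / 2 - s ^ 2 * β = (β * (ρ + s)) * (ρ - s) := by rw [← hρβ]; ring
        rw [this]
        refine mul_le_mul_of_nonneg_right ?_ (by linarith)
        nlinarith
      rw [hhE]
      nlinarith [mul_nonneg (sq_nonneg s) (by linarith : 0 ≤ β)]
    have h4 : (ρ - s)⁻¹ ≤ 1 / hE (s • u) := by
      rw [← one_div]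
      exact one_div_le_one_div_of_le (hE_pos hmem) hle
    have h5 : 0 < (ρ - s)⁻¹ := inv_pos.2 (by linarith)
    have h6 : 0 < 1 / hU (s • u) := one_div_pos.2 (hU_pos hmem.1)
    unfold gdens
    linarith
  · refine ⟨1, one_pos, fun s h0 h1 => ?_⟩
    have hmem : s • u ∈ ballU \ setH := by
      refine ⟨hball h0 h1, ?_⟩
      rintro ⟨-, h2, h3⟩
      simp only [PiLp.smul_apply, smul_eq_mul] at h2 h3
      have hs : s ≠ 0 := by rintro rfl; norm_num at h3
      refine h (sq_eq_sq_iff_eq_or_eq_neg.2 (h2.imp (mul_left_cancel₀ hs)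
        fun h => mul_left_cancel₀ hs (by linarith)))
    refine ⟨hmem, ?_⟩
    have hhU : hU (s • u) = (1 - s) * (1 + s) := by
      simp only [hU, norm_smul, hu, Real.norm_of_nonneg h0]; ring
    have h4 : (1 / 2) * (1 - s)⁻¹ ≤ 1 / hU (s • u) := by
      have : (1 / 2) * (1 - s)⁻¹ = 1 / (2 * (1 - s)) := by
        rw [one_div, one_div, mul_inv]
      rw [this]
      exact one_div_le_one_div_of_le (hU_pos hmem.1) (by rw [hhU]; nlinarith)
    have h6 : 0 < 1 / hE (s • u) := one_div_pos.2 (hE_pos hmem)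
    unfold gdens
    linarith

theorem integral_half_inv_sub {ρ t : ℝ} (h0 : 0 ≤ t) (ht : t < ρ) :
    ∫ s in (0 : ℝ)..t, (1 / 2) * (ρ - s)⁻¹ = (1 / 2) * (Real.log ρ - Real.log (ρ - t)) := by
  have hd : ∀ s ∈ uIcc 0 t, HasDerivAt (fun s => -(1 / 2) * Real.log (ρ - s))
      ((1 / 2) * (ρ - s)⁻¹) s := by
    intro s hs
    rw [uIcc_of_le h0] at hs
    have h1 : HasDerivAt (fun s => ρ - s) (-1) s := by
      simpa using (hasDerivAt_id s).const_sub ρ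
    have h2 := (h1.log (by linarith [hs.2])).const_mul (-(1 / 2))
    refine h2.congr_deriv ?_
    ring
  rw [intervalIntegral.integral_eq_sub_of_hasDerivAt hd]
  · rw [sub_zero]; ring
  · refine ContinuousOn.intervalIntegrable ?_
    rw [uIcc_of_le h0]
    exact continuousOn_const.mul (ContinuousOn.inv₀ (by fun_prop)
      fun s hs => by linarith [hs.2])

/-- Intermediate value theorem for `t ↦ t g(t u)` on the ray through `p`: it vanishes at `0` and
dominates a multiple of a logarithm that diverges at the end of the ray. -/
theorem exists_gfun_smul_eq (p : E3) : ∃ m ∈ ballU \ setH, gfun m • m = p := by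
  rcases eq_or_ne p 0 with rfl | hp
  · exact ⟨0, zero_mem_ballU_diff_setH, smul_zero _⟩
  have hp0 : 0 < ‖p‖ := norm_pos_iff.2 hp
  set u : E3 := ‖p‖⁻¹ • p with hu'
  have hu : ‖u‖ = 1 := by
    rw [hu', norm_smul, norm_inv, norm_norm, inv_mul_cancel₀ hp0.ne']
  have hpu : p = ‖p‖ • u := by rw [hu', smul_smul, mul_inv_cancel₀ hp0.ne', one_smul]
  obtain ⟨ρ, hρ, hray⟩ := exists_ray_end hu
  have hlim : Tendsto (fun t : ℝ => t ^ 2 * ((1 / 2) * (Real.log ρ - Real.log (ρ - t))))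
      (𝓝[<] ρ) atTop := by
    have h1 : Tendsto (fun t : ℝ => t ^ 2) (𝓝[<] ρ) (𝓝 (ρ ^ 2)) :=
      ((continuous_pow 2).tendsto ρ).mono_left nhdsWithin_le_nhds
    refine h1.pos_mul_atTop (by positivity) (Tendsto.const_mul_atTop (by norm_num) ?_)
    have h2 : Tendsto (fun t : ℝ => ρ - t) (𝓝[<] ρ) (𝓝[>] 0) := by
      refine tendsto_nhdsWithin_iff.2 ⟨?_, ?_⟩
      · have : Tendsto (fun t : ℝ => ρ - t) (𝓝 ρ) (𝓝 (ρ - ρ)) :=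
          (continuous_const.sub continuous_id).tendsto ρ
        rw [sub_self] at this
        exact this.mono_left nhdsWithin_le_nhds
      · filter_upwards [self_mem_nhdsWithin] with t ht
        exact sub_pos.2 (mem_Iio.1 ht)
    have h3 := tendsto_neg_atBot_atTop.comp (Real.tendsto_log_nhdsGT_zero.comp h2)
    exact tendsto_atTop_add_const_left _ (Real.log ρ) h3
  obtain ⟨t₁, ht₁, ht₁'⟩ := ((hlim.eventually_ge_atTop ‖p‖).and (Ioo_mem_nhdsLT hρ)).exists
  have hsub : ∀ s ∈ Icc 0 t₁, s • u ∈ ballU \ setH :=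
    fun s hs => (hray s hs.1 (hs.2.trans_lt ht₁'.2)).1
  have hcont : ContinuousOn (fun t : ℝ => t * gfun (t • u)) (Icc 0 t₁) := by
    refine continuousOn_id.mul fun t ht => ?_
    have : ContinuousAt gfun (t • u) := (differentiableAt_gfun (hsub t ht)).continuousAt
    exact (ContinuousAt.comp (f := fun t : ℝ => t • u) this (by fun_prop)).continuousWithinAt
  have hbig : ‖p‖ ≤ t₁ * gfun (t₁ • u) := by
    refine ht₁.trans ?_
    rw [gfun_smul u ht₁'.1.le, hu, one_pow, mul_one, ← integral_half_inv_sub ht₁'.1.le ht₁'.2]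
    have hmono : (∫ s in (0 : ℝ)..t₁, (1 / 2) * (ρ - s)⁻¹) ≤ ∫ s in (0 : ℝ)..t₁, gdens (s • u) := by
      refine intervalIntegral.integral_mono_on ht₁'.1.le ?_
        (intervalIntegrable_gdens ht₁'.1.le hsub)
        fun s hs => (hray s hs.1 (hs.2.trans_lt ht₁'.2)).2
      refine ContinuousOn.intervalIntegrable ?_
      rw [uIcc_of_le ht₁'.1.le]
      exact continuousOn_const.mul (ContinuousOn.inv₀ (by fun_prop)
        fun s hs => by linarith [hs.2, ht₁'.2])
    nlinarith [mul_le_mul_of_nonneg_left hmono (sq_nonneg t₁), ht₁'.1]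
  obtain ⟨t, ht, hteq⟩ := intermediate_value_Icc ht₁'.1.le hcont
    (show ‖p‖ ∈ Icc _ _ from ⟨by simp, hbig⟩)
  refine ⟨t • u, hsub t ht, ?_⟩
  rw [smul_smul, mul_comm, hpu]
  exact congrArg (· • u) hteq

/-! ### The differentials of `𝒩` and `𝒟` -/

/-- The differential of `𝒩`. -/
def derivN (x : E4) : E4 →L[ℝ] E4 :=
  gfun x.2 • ((Real.cos x.1 • ContinuousLinearMap.fst ℝ ℝ E3).prod
      (ContinuousLinearMap.snd ℝ ℝ E3))
    + ((fderiv ℝ gfun x.2).comp (ContinuousLinearMap.snd ℝ ℝ E3)).smulRight (Real.sin x.1, x.2)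

theorem hasFDerivAt_mapN {x : E4} (hx : x.2 ∈ ballU \ setH) :
    HasFDerivAt mapN (derivN x) x := by
  have h1 : HasFDerivAt (fun x : E4 => gfun x.2)
      ((fderiv ℝ gfun x.2).comp (ContinuousLinearMap.snd ℝ ℝ E3)) x :=
    (differentiableAt_gfun hx).hasFDerivAt.comp x hasFDerivAt_snd
  have h2 : HasFDerivAt (fun x : E4 => (Real.sin x.1, x.2))
      ((Real.cos x.1 • ContinuousLinearMap.fst ℝ ℝ E3).prod (ContinuousLinearMap.snd ℝ ℝ E3)) x :=
    HasFDerivAt.prodMk (hasFDerivAt_fst.sin) hasFDerivAt_snd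
  exact h1.smul h2

/-- Applying `dg` to the spatial equation gives `(g + dg(m)) dg(w) = 0`, where `m` is the base point
and `w` stands for its own spatial part. Radial monotonicity makes the first factor positive, so
`dg(w) = 0` and the equations decouple. -/
theorem derivN_injective {x : E4} (hx : x.2 ∈ ballU \ setH) (hcos : Real.cos x.1 ≠ 0) {w : E4}
    (hw : derivN x w = 0) : w = 0 := by
  have hg : 0 < gfun x.2 := zero_lt_one.trans_le (one_le_gfun hx)
  have h1 : gfun x.2 * (Real.cos x.1 * w.1) + fderiv ℝ gfun x.2 w.2 * Real.sin x.1 = 0 :=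
    congrArg Prod.fst hw
  have h2 : gfun x.2 • w.2 + fderiv ℝ gfun x.2 w.2 • x.2 = 0 := congrArg Prod.snd hw
  have h3 : fderiv ℝ gfun x.2 w.2 = 0 := by
    have h4 := congrArg (fderiv ℝ gfun x.2) h2
    rw [map_add, map_smul, map_smul, map_zero, smul_eq_mul, smul_eq_mul] at h4
    have h5 := fderiv_gfun_self_nonneg hx
    have h6 : (gfun x.2 + fderiv ℝ gfun x.2 x.2) * fderiv ℝ gfun x.2 w.2 = 0 := by
      linear_combination h4
    exact (mul_eq_zero.1 h6).resolve_left (by linarith)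
  rw [h3, zero_smul, add_zero] at h2
  rw [h3, zero_mul, add_zero] at h1
  refine Prod.ext ?_ ((smul_eq_zero.1 h2).resolve_left hg.ne')
  exact (mul_eq_zero.1 ((mul_eq_zero.1 h1).resolve_left hg.ne')).resolve_left hcos

theorem derivN_zero : derivN 0 = ContinuousLinearMap.id ℝ E4 := by
  ext w <;> simp [derivN, gfun_zero]

theorem contDiffAt_mapN {x : E4} (hx : x.2 ∈ ballU \ setH) : ContDiffAt ℝ ⊤ mapN x := by
  have h1 : ContDiffAt ℝ ⊤ (fun x : E4 => gfun x.2) x := (contDiffAt_gfun hx).comp x contDiffAt_snd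
  have h2 : ContDiffAt ℝ ⊤ (fun x : E4 => (Real.sin x.1, x.2)) x := by fun_prop
  exact h1.smul h2

theorem mapD_covProj (ε : ℤˣ) (x : E4) : mapD ε (covProj x) = mapN (x.1, nvec ε x.2) := rfl

/-- The differential of `𝒟`, lifted to the covering space. -/
def derivD (ε : ℤˣ) (x : E4) : E4 →L[ℝ] E4 :=
  (derivN (x.1, nvec ε x.2)).comp
    ((ContinuousLinearMap.id ℝ ℝ).prodMap (fderiv ℝ (nvec ε) x.2))

theorem hasFDerivAt_mapD {ε : ℤˣ} {x : E4} (hx : nvec ε x.2 ∈ ballU \ setH) :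
    HasFDerivAt (fun x : E4 => mapD ε (covProj x)) (derivD ε x) x := by
  have h1 : HasFDerivAt (fun x : E4 => ((x.1, nvec ε x.2) : E4))
      ((ContinuousLinearMap.id ℝ ℝ).prodMap (fderiv ℝ (nvec ε) x.2)) x :=
    HasFDerivAt.prodMap (f := id) (p := x) (hasFDerivAt_id _) (differentiable_nvec ε x.2).hasFDerivAt
  have h2 : HasFDerivAt mapN (derivN (x.1, nvec ε x.2)) (x.1, nvec ε x.2) := hasFDerivAt_mapN hx
  exact h2.comp x h1

theorem contDiffAt_mapD {ε : ℤˣ} {x : E4} (hx : nvec ε x.2 ∈ ballU \ setH) :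
    ContDiffAt ℝ ⊤ (fun x : E4 => mapD ε (covProj x)) x := by
  have h1 : ContDiffAt ℝ ⊤ (fun x : E4 => ((x.1, nvec ε x.2) : E4)) x :=
    contDiffAt_fst.prodMk ((contDiff_nvec ε).contDiffAt.comp x contDiffAt_snd)
  have h2 : ContDiffAt ℝ ⊤ mapN (x.1, nvec ε x.2) := contDiffAt_mapN hx
  exact h2.comp x h1

theorem derivD_kCenter (ε : ℤˣ) (i : Fin 4) : derivD ε (0, kCenter ε i) = jac i := by
  have h : (((0 : ℝ), nvec ε (kCenter ε i)) : E4) = 0 := by rw [nvec_kCenter]; rfl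
  rw [derivD, jac]
  simp only
  rw [h, derivN_zero, fderiv_nvec_kCenter]
  rfl

/-! ### `𝒟` is a bijection from `Σ_i` onto the null mass shell -/

theorem minkowskiSq_mapN (x : E4) :
    minkowskiSq (mapN x) = gfun x.2 ^ 2 * (Real.sin x.1 ^ 2 - ‖x.2‖ ^ 2) := by
  change (gfun x.2 * Real.sin x.1) ^ 2 - ‖gfun x.2 • x.2‖ ^ 2 = _
  rw [norm_smul, mul_pow, mul_pow, Real.norm_eq_abs, sq_abs]
  ring

theorem mapN_mem_nullShell_iff {x : E4} (hx : x.2 ∈ ballU \ setH) :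
    mapN x ∈ nullShell ↔ Real.sin x.1 ^ 2 - ‖x.2‖ ^ 2 = 0 := by
  have hg : 0 < gfun x.2 := zero_lt_one.trans_le (one_le_gfun hx)
  change minkowskiSq (mapN x) = 0 ↔ _
  rw [minkowskiSq_mapN, mul_eq_zero, or_iff_right (pow_pos hg 2).ne']

theorem covProj_surjective : Function.Surjective covProj := by
  rintro ⟨ω, κ⟩
  obtain ⟨k, rfl⟩ := toBrillouin_surjective κ
  exact ⟨(ω, k), rfl⟩

theorem covProj_mem_solutions {ε : ℤˣ} {i : Fin 4} {x : E4} : covProj x ∈ solutions ε i ↔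
    toBrillouin x.2 ∈ region ε i ∧ |x.1| ≤ Real.pi / 2 ∧
      Real.sin x.1 ^ 2 - ‖nvec ε x.2‖ ^ 2 = 0 := Iff.rfl

theorem mapsTo_mapD (ε : ℤˣ) (i : Fin 4) : MapsTo (mapD ε) (solutions ε i) nullShell := by
  intro x hx
  exact (mapN_mem_nullShell_iff (x := mapP ε x) hx.1.2).2 hx.2.2

theorem injOn_mapD (ε : ℤˣ) (i : Fin 4) : InjOn (mapD ε) (solutions ε i) := by
  intro x hx y hy h
  obtain ⟨⟨ω, k⟩, rfl⟩ := covProj_surjective x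
  obtain ⟨⟨ω', l⟩, rfl⟩ := covProj_surjective y
  rw [covProj_mem_solutions] at hx hy
  have h1 : gfun (nvec ε k) * Real.sin ω = gfun (nvec ε l) * Real.sin ω' := congrArg Prod.fst h
  have h2 : gfun (nvec ε k) • nvec ε k = gfun (nvec ε l) • nvec ε l := congrArg Prod.snd h
  have hn : nvec ε k = nvec ε l := injOn_gfun_smul hx.1.2 hy.1.2 h2
  have hg : 0 < gfun (nvec ε l) := zero_lt_one.trans_le (one_le_gfun hy.1.2)
  rw [hn] at h1
  have hω : ω = ω' := Real.injOn_sin (abs_le.1 hx.2.1) (abs_le.1 hy.2.1)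
    (mul_left_cancel₀ hg.ne' h1)
  exact Prod.ext hω (toBrillouin_eq_of_nvec_eq hx.1.1 hy.1.1 hn)

theorem surjOn_mapD (ε : ℤˣ) (i : Fin 4) : SurjOn (mapD ε) (solutions ε i) nullShell := by
  intro p hp
  obtain ⟨m, hm, hmp⟩ := exists_gfun_smul_eq p.2
  obtain ⟨k, hk, rfl⟩ := exists_nvec_eq ε i hm
  have hg : 0 < gfun (nvec ε k) := zero_lt_one.trans_le (one_le_gfun hm)
  have hm1 : ‖nvec ε k‖ < 1 := hm.1
  have hp' : p.1 ^ 2 - ‖p.2‖ ^ 2 = 0 := hp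
  have hs : (p.1 / gfun (nvec ε k)) ^ 2 = ‖nvec ε k‖ ^ 2 := by
    rw [← hmp, norm_smul, mul_pow, Real.norm_eq_abs, sq_abs] at hp'
    rw [div_pow, div_eq_iff (pow_pos hg 2).ne']
    linarith
  have habs : |p.1 / gfun (nvec ε k)| < 1 := by
    rw [← abs_norm] at hm1
    exact (sq_eq_sq_iff_abs_eq_abs _ _).1 hs ▸ hm1
  have hsin := Real.sin_arcsin (abs_lt.1 habs).1.le (abs_lt.1 habs).2.le
  refine ⟨covProj (Real.arcsin (p.1 / gfun (nvec ε k)), k),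
    covProj_mem_solutions.2 ⟨hk, abs_le.2 (Real.arcsin_mem_Icc _), ?_⟩, ?_⟩
  · simp only
    rw [hsin, hs, sub_self]
  · refine Prod.ext ?_ hmp
    change gfun (nvec ε k) * Real.sin (Real.arcsin (p.1 / gfun (nvec ε k))) = p.1
    rw [hsin, mul_div_cancel₀ _ hg.ne']

theorem bijOn_mapD (ε : ℤˣ) (i : Fin 4) : BijOn (mapD ε) (solutions ε i) nullShell :=
  ⟨mapsTo_mapD ε i, injOn_mapD ε i, surjOn_mapD ε i⟩

/-! ### Local inverses of `𝒟` -/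

/-- The end points would give `sin² ω = 1`, whereas `|n| < 1`. Strictness provides both `cos ω ≠ 0`
and an open condition for the local inverse. -/
theorem abs_lt_pi_div_two {ε : ℤˣ} {i : Fin 4} {x : E4} (hx : covProj x ∈ solutions ε i) :
    |x.1| < Real.pi / 2 := by
  rw [covProj_mem_solutions] at hx
  refine hx.2.1.lt_of_ne fun h => ?_
  have h1 : Real.sin x.1 ^ 2 = 1 := by
    rw [← sq_abs, Real.abs_sin_eq_sin_abs_of_abs_le_pi (by linarith [Real.pi_pos]), h]
    simp
  have h2 : ‖nvec ε x.2‖ < 1 := hx.1.2.1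
  have h3 := hx.2.2
  rw [h1] at h3
  nlinarith [norm_nonneg (nvec ε x.2)]

theorem isOpen_region (ε : ℤˣ) (i : Fin 4) : IsOpen {k : E3 | toBrillouin k ∈ region ε i} := by
  have h1 : IsOpen {k : E3 | 0 < lamSign i * lam ε k} :=
    isOpen_lt continuous_const (continuous_const.mul (continuous_lam ε))
  have h2 : IsOpen {k : E3 | 0 < cosSign i * Real.cos (2 * k 1)} :=
    isOpen_lt continuous_const (by fun_prop)
  have h3 : IsOpen (nvec ε ⁻¹' (ballU \ setH)) :=
    isOpen_ballU_diff_setH.preimage (differentiable_nvec ε).continuous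
  exact (h1.inter h2).inter h3

theorem derivD_injective {ε : ℤˣ} {i : Fin 4} {x : E4} (hx : covProj x ∈ solutions ε i) :
    Function.Injective (derivD ε x) := by
  have hω := abs_lt_pi_div_two hx
  rw [covProj_mem_solutions] at hx
  have hcos : Real.cos x.1 ≠ 0 :=
    (Real.cos_pos_of_mem_Ioo (abs_lt.1 hω)).ne'
  rw [injective_iff_map_eq_zero]
  intro w hw
  have h := derivN_injective (x := (x.1, nvec ε x.2)) hx.1.2 hcos hw
  have h1 : w.1 = 0 := congrArg Prod.fst h
  have h2 : fderiv ℝ (nvec ε) x.2 w.2 = 0 := congrArg Prod.snd h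
  exact Prod.ext h1 (fderiv_nvec_injective (right_ne_zero_of_mul hx.1.1.1.ne')
    (right_ne_zero_of_mul hx.1.1.2.ne') h2)

theorem exists_equiv_derivD {ε : ℤˣ} {i : Fin 4} {x : E4} (hx : covProj x ∈ solutions ε i) :
    ∃ J : E4 ≃L[ℝ] E4, (J : E4 →L[ℝ] E4) = derivD ε x :=
  ⟨(LinearEquiv.ofInjectiveEndo (derivD ε x : E4 →ₗ[ℝ] E4)
    (derivD_injective hx)).toContinuousLinearEquiv, by ext <;> rfl⟩

/-- The inverse function theorem is applied to the full map of four variables. The region and the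
strict bound on `ω` are open conditions, and positivity of `g` turns the null condition on `p` into
the dispersion relation. -/
theorem exists_local_inverse {ε : ℤˣ} {i : Fin 4} {x : E4} (hx : covProj x ∈ solutions ε i)
    {J : E4 ≃L[ℝ] E4} (hJ : (J : E4 →L[ℝ] E4) = derivD ε x) :
    ∃ Φ : E4 → E4, AnalyticAt ℝ Φ (mapD ε (covProj x)) ∧ Φ (mapD ε (covProj x)) = x ∧
      HasFDerivAt Φ (J.symm : E4 →L[ℝ] E4) (mapD ε (covProj x)) ∧
      ∀ᶠ p in 𝓝 (mapD ε (covProj x)), p ∈ nullShell →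
        covProj (Φ p) ∈ solutions ε i ∧ mapD ε (covProj (Φ p)) = p := by
  have hc : ContDiffAt ℝ ⊤ (fun x : E4 => mapD ε (covProj x)) x := contDiffAt_mapD hx.1.2
  have hd : HasFDerivAt (fun x : E4 => mapD ε (covProj x)) (J : E4 →L[ℝ] E4) x := by
    rw [hJ]; exact hasFDerivAt_mapD hx.1.2
  have hs := hc.hasStrictFDerivAt' hd (by simp)
  have himg : hc.localInverse hd (by simp) (mapD ε (covProj x)) = x :=
    hc.localInverse_apply_image hd (by simp)
  have han : AnalyticAt ℝ (hc.localInverse hd (by simp)) (mapD ε (covProj x)) :=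
    (hc.to_localInverse hd (by simp)).analyticAt
  refine ⟨hc.localInverse hd (by simp), han, himg, hs.to_localInverse.hasFDerivAt, ?_⟩
  have hopen : {y : E4 | |y.1| < Real.pi / 2 ∧ toBrillouin y.2 ∈ region ε i} ∈ 𝓝 x := by
    refine IsOpen.mem_nhds ?_ ⟨abs_lt_pi_div_two hx, hx.1⟩
    have h1 : IsOpen {y : E4 | |y.1| < Real.pi / 2} :=
      isOpen_lt (by fun_prop) continuous_const
    exact h1.inter ((isOpen_region ε i).preimage continuous_snd)
  have hev : ∀ᶠ p in 𝓝 (mapD ε (covProj x)), hc.localInverse hd (by simp) p ∈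
      {y : E4 | |y.1| < Real.pi / 2 ∧ toBrillouin y.2 ∈ region ε i} :=
    han.continuousAt.eventually (by rw [himg]; exact hopen)
  filter_upwards [hev, hs.eventually_right_inverse] with p h1 h2 hp
  change mapD ε (covProj (hc.localInverse hd (by simp) p)) = p at h2
  refine ⟨covProj_mem_solutions.2 ⟨h1.2, h1.1.le, ?_⟩, h2⟩
  rw [← h2] at hp
  exact (mapN_mem_nullShell_iff (x := (_, nvec ε _)) h1.2.2).1 hp

/-! ### Analyticity of `𝒟`, of its inverse and of the Lorentz transformations -/

theorem IsAnalyticMapOn.comp {V W V' X Y Z : Type} [NormedAddCommGroup V] [NormedSpace ℝ V]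
    [NormedAddCommGroup W] [NormedSpace ℝ W] [NormedAddCommGroup V'] [NormedSpace ℝ V']
    {pX : V → X} {pY : W → Y} {pZ : V' → Z} {F : X → Y} {G : Y → Z} {S : Set X} {T : Set Y}
    (hG : IsAnalyticMapOn pY pZ G T) (hF : IsAnalyticMapOn pX pY F S) (hST : MapsTo F S T) :
    IsAnalyticMapOn pX pZ (fun x => G (F x)) S := by
  intro v hv
  obtain ⟨Ft, hFt, hF'⟩ := hF v hv
  have hFv := hF'.self_of_nhds hv
  obtain ⟨Gt, hGt, hG'⟩ := hG (Ft v) (hFv ▸ hST hv)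
  refine ⟨fun u => Gt (Ft u), hGt.comp hFt, ?_⟩
  filter_upwards [hF', hFt.continuousAt.eventually hG'] with u h1 h2 hu
  rw [h1 hu]
  exact h2 (h1 hu ▸ hST hu)

theorem isAnalyticMapOn_mapD (ε : ℤˣ) (i : Fin 4) :
    IsAnalyticMapOn covProj (id : E4 → E4) (mapD ε) (solutions ε i) := fun _ hv =>
  ⟨_, (contDiffAt_mapD hv.1.2).analyticAt, Eventually.of_forall fun _ _ => rfl⟩

/-- The inverse of `𝒟^(i)`. -/
def invD (ε : ℤˣ) (i : Fin 4) : E4 → ℝ × Brillouin :=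
  Function.invFunOn (mapD ε) (solutions ε i)

theorem invOn_invD (ε : ℤˣ) (i : Fin 4) :
    InvOn (invD ε i) (mapD ε) (solutions ε i) nullShell :=
  (bijOn_mapD ε i).invOn_invFunOn

theorem mapsTo_invD (ε : ℤˣ) (i : Fin 4) : MapsTo (invD ε i) nullShell (solutions ε i) :=
  (surjOn_mapD ε i).mapsTo_invFunOn

theorem invD_eq {ε : ℤˣ} {i : Fin 4} {p : E4} {y : ℝ × Brillouin}
    (hy : y ∈ solutions ε i) (h : mapD ε y = p) : invD ε i p = y := by
  rw [← h]; exact (invOn_invD ε i).1 hy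

theorem isAnalyticMapOn_invD (ε : ℤˣ) (i : Fin 4) :
    IsAnalyticMapOn (id : E4 → E4) covProj (invD ε i) nullShell := by
  intro p hp
  obtain ⟨x, hx⟩ := covProj_surjective (invD ε i p)
  have hxs : covProj x ∈ solutions ε i := hx ▸ mapsTo_invD ε i hp
  have hxp : mapD ε (covProj x) = p := by rw [hx]; exact (invOn_invD ε i).2 hp
  obtain ⟨J, hJ⟩ := exists_equiv_derivD hxs
  obtain ⟨Φ, h1, -, -, h4⟩ := exists_local_inverse hxs hJ
  rw [hxp] at h1 h4
  refine ⟨Φ, h1, ?_⟩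
  filter_upwards [h4] with q hq hq'
  exact invD_eq (hq hq').1 (hq hq').2

theorem isAnalyticDiffeo_mapD (ε : ℤˣ) (i : Fin 4) :
    IsAnalyticDiffeo covProj (id : E4 → E4) (mapD ε) (solutions ε i) nullShell :=
  ⟨bijOn_mapD ε i, isAnalyticMapOn_mapD ε i, invD ε i, invOn_invD ε i, isAnalyticMapOn_invD ε i⟩

theorem mapsTo_lorentz (L : LorentzGroup) :
    MapsTo (L : E4 ≃L[ℝ] E4) nullShell nullShell := by
  intro p hp
  change minkowskiSq _ = 0
  rw [L.2 p]
  exact hp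

theorem mapL_eq (ε : ℤˣ) (i : Fin 4) (L : LorentzGroup) (x : ℝ × Brillouin) :
    mapL ε i L x = invD ε i ((L : E4 ≃L[ℝ] E4) (mapD ε x)) := rfl

theorem mapsTo_mapL (ε : ℤˣ) (i : Fin 4) (L : LorentzGroup) :
    MapsTo (mapL ε i L) (solutions ε i) (solutions ε i) := fun _ hx =>
  mapsTo_invD ε i (mapsTo_lorentz L (mapsTo_mapD ε i hx))

theorem mapD_mapL {ε : ℤˣ} {i : Fin 4} (L : LorentzGroup) {x : ℝ × Brillouin}
    (hx : x ∈ solutions ε i) : mapD ε (mapL ε i L x) = (L : E4 ≃L[ℝ] E4) (mapD ε x) :=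
  (invOn_invD ε i).2 (mapsTo_lorentz L (mapsTo_mapD ε i hx))

theorem mapL_mul {ε : ℤˣ} {i : Fin 4} (L M : LorentzGroup) {x : ℝ × Brillouin}
    (hx : x ∈ solutions ε i) : mapL ε i (L * M) x = mapL ε i L (mapL ε i M x) := by
  rw [mapL_eq ε i L, mapD_mapL M hx]
  rfl

theorem mapL_one {ε : ℤˣ} {i : Fin 4} {x : ℝ × Brillouin} (hx : x ∈ solutions ε i) :
    mapL ε i 1 x = x := (invOn_invD ε i).1 hx

theorem isAnalyticMapOn_mapL (ε : ℤˣ) (i : Fin 4) (L : LorentzGroup) :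
    IsAnalyticMapOn covProj covProj (mapL ε i L) (solutions ε i) := by
  have hL : IsAnalyticMapOn (id : E4 → E4) (id : E4 → E4) (L : E4 ≃L[ℝ] E4) nullShell :=
    fun p _ => ⟨_, ((L : E4 ≃L[ℝ] E4) : E4 →L[ℝ] E4).analyticAt p,
      Eventually.of_forall fun _ _ => rfl⟩
  exact (isAnalyticMapOn_invD ε i).comp (hL.comp (isAnalyticMapOn_mapD ε i) (mapsTo_mapD ε i))
    ((mapsTo_lorentz L).comp (mapsTo_mapD ε i))

theorem invOn_mapL (ε : ℤˣ) (i : Fin 4) (L : LorentzGroup) :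
    InvOn (mapL ε i L⁻¹) (mapL ε i L) (solutions ε i) (solutions ε i) := by
  constructor
  · intro x hx
    rw [← mapL_mul _ _ hx, inv_mul_cancel, mapL_one hx]
  · intro x hx
    rw [← mapL_mul _ _ hx, mul_inv_cancel, mapL_one hx]

theorem isAnalyticDiffeo_mapL (ε : ℤˣ) (i : Fin 4) (L : LorentzGroup) :
    IsAnalyticDiffeo covProj covProj (mapL ε i L) (solutions ε i) (solutions ε i) :=
  ⟨(invOn_mapL ε i L).bijOn (mapsTo_mapL ε i L) (mapsTo_mapL ε i L⁻¹),
    isAnalyticMapOn_mapL ε i L, mapL ε i L⁻¹, invOn_mapL ε i L, isAnalyticMapOn_mapL ε i L⁻¹⟩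

/-- The representation of the Lorentz group on `Σ_i`. -/
def lorentzRep (ε : ℤˣ) (i : Fin 4) : LorentzGroup →* Equiv.Perm (solutions ε i) :=
  MonoidHom.toHomPerm
    { toFun := fun L x => ⟨mapL ε i L x, mapsTo_mapL ε i L x.2⟩
      map_one' := funext fun x => Subtype.ext (mapL_one x.2)
      map_mul' := fun L M => funext fun x => Subtype.ext (mapL_mul L M x.2) }

theorem lorentzRep_apply (ε : ℤˣ) (i : Fin 4) (L : LorentzGroup) (x : solutions ε i) :
    (lorentzRep ε i L x : ℝ × Brillouin) = mapL ε i L x := rfl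

/-! ### The linear limit at the centres -/

theorem jac_comp_jac (i : Fin 4) : (jac i).comp (jac i) = ContinuousLinearMap.id ℝ E4 := by
  have h : Matrix.diagonal (reflSign i) * Matrix.diagonal (reflSign i) = 1 := by
    rw [Matrix.diagonal_mul_diagonal, ← Matrix.diagonal_one]
    congr 1
    funext j
    fin_cases i <;> fin_cases j <;> simp [reflSign]
  have h2 : (Matrix.toEuclideanCLM (n := Fin 3) (𝕜 := ℝ) (Matrix.diagonal (reflSign i))).comp
      (Matrix.toEuclideanCLM (n := Fin 3) (𝕜 := ℝ) (Matrix.diagonal (reflSign i))) =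
      ContinuousLinearMap.id ℝ E3 := by
    rw [← ContinuousLinearMap.mul_def, ← map_mul, h, map_one, ContinuousLinearMap.one_def]
  refine ContinuousLinearMap.ext fun w => Prod.ext rfl ?_
  exact DFunLike.congr_fun h2 w.2

/-- The differential of `𝒟` at the centre of `Σ_i`, as an equivalence. -/
def jacEquiv (i : Fin 4) : E4 ≃L[ℝ] E4 :=
  ContinuousLinearEquiv.equivOfInverse (jac i) (jac i)
    (fun w => DFunLike.congr_fun (jac_comp_jac i) w)
    (fun w => DFunLike.congr_fun (jac_comp_jac i) w)

theorem kCenter_mem_solutions (ε : ℤˣ) (i : Fin 4) :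
    covProj (0, kCenter ε i) ∈ solutions ε i := by
  refine covProj_mem_solutions.2 ⟨kCenter_mem_region ε i, ?_, ?_⟩
  · simpa using Real.pi_div_two_pos.le
  · simp [nvec_kCenter]

theorem mapD_kCenter (ε : ℤˣ) (i : Fin 4) : mapD ε (covProj (0, kCenter ε i)) = 0 := by
  rw [mapD_covProj]
  simp only [nvec_kCenter]
  simp [mapN]

theorem hasFDerivAt_mapD_kCenter (ε : ℤˣ) (i : Fin 4) :
    HasFDerivAt (fun x : E4 => mapD ε (covProj x)) (jac i) (0, kCenter ε i) := by
  rw [← derivD_kCenter ε i]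
  exact hasFDerivAt_mapD (kCenter_mem_solutions ε i).1.2

/-- The lift is `Φ ∘ L ∘ 𝒟` with `Φ` the local inverse at the centre. `J_i` is an involution, so
`J_i⁻¹ L J_i` appears as `J_i L J_i`. -/
theorem exists_mapL_lift (ε : ℤˣ) (i : Fin 4) (L : LorentzGroup) :
    ∃ F : E4 → E4, AnalyticAt ℝ F (0, kCenter ε i) ∧
      (∀ᶠ u in 𝓝 ((0, kCenter ε i) : E4),
        covProj u ∈ solutions ε i → mapL ε i L (covProj u) = covProj (F u)) ∧
      F (0, kCenter ε i) = (0, kCenter ε i) ∧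
      HasFDerivAt F ((jac i).comp (((L : E4 ≃L[ℝ] E4) : E4 →L[ℝ] E4).comp (jac i)))
        (0, kCenter ε i) := by
  have hmem := kCenter_mem_solutions ε i
  obtain ⟨Φ, h1, h2, h3, h4⟩ := exists_local_inverse hmem
    (J := jacEquiv i) (derivD_kCenter ε i).symm
  have hanD : AnalyticAt ℝ (fun x : E4 => mapD ε (covProj x)) (0, kCenter ε i) :=
    (contDiffAt_mapD hmem.1.2).analyticAt
  have hL0 : (L : E4 ≃L[ℝ] E4) (mapD ε (covProj (0, kCenter ε i))) =
      mapD ε (covProj (0, kCenter ε i)) := by rw [mapD_kCenter, map_zero]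
  have hanLD : AnalyticAt ℝ (fun x : E4 => (L : E4 ≃L[ℝ] E4) (mapD ε (covProj x)))
      (0, kCenter ε i) :=
    (((L : E4 ≃L[ℝ] E4) : E4 →L[ℝ] E4).analyticAt _).comp hanD
  have hdLD : HasFDerivAt (fun x : E4 => (L : E4 ≃L[ℝ] E4) (mapD ε (covProj x)))
      (((L : E4 ≃L[ℝ] E4) : E4 →L[ℝ] E4).comp (jac i)) (0, kCenter ε i) :=
    ((L : E4 ≃L[ℝ] E4) : E4 →L[ℝ] E4).hasFDerivAt.comp _ (hasFDerivAt_mapD_kCenter ε i)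
  -- The centre is sent to `0`, which `L` fixes, so the same local inverse serves after applying
  -- `L`.
  rw [← hL0] at h1 h2 h3 h4
  refine ⟨fun u => Φ ((L : E4 ≃L[ℝ] E4) (mapD ε (covProj u))), ?_, ?_, h2, ?_⟩
  · exact AnalyticAt.comp (g := Φ) h1 hanLD
  · filter_upwards [hanLD.continuousAt.eventually h4] with u hu hus
    obtain ⟨h5, h6⟩ := hu (mapsTo_lorentz L (mapsTo_mapD ε i hus))
    exact invD_eq h5 h6
  · exact HasFDerivAt.comp (g := Φ) _ h3 hdLD

/-! ### The regions cover the Brillouin zone up to a null set -/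

/-- A measurable set that meets each line in a given direction in a countable set is null. -/
theorem volume_eq_zero_of_countable_lines {S : Set E3} (hS : MeasurableSet S) (v : E3)
    (h : ∀ k : E3, {t : ℝ | k + t • v ∈ S}.Countable) : volume S = 0 := by
  have := ae_mem_of_ae_add_linearMap_mem (LinearMap.toSpanSingleton ℝ E3 v) volume volume
    hS.compl fun k => by
      refine measure_mono_null (fun t ht => ?_) ((h k).measure_zero volume)
      simpa using ht
  simpa [ae_iff] using this

theorem countable_sin_add_eq_zero (a : ℝ) : {t : ℝ | Real.sin (a + t) = 0}.Countable := by
  refine (countable_range fun n : ℤ => n * Real.pi - a).mono fun t ht => ?_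
  obtain ⟨n, hn⟩ := Real.sin_eq_zero_iff.1 ht
  exact ⟨n, by simp only; linarith⟩

/-- A nontrivial combination of sine and cosine has countably many zeros. -/
theorem countable_trig_zeros {A B : ℝ} (hB : B ≠ 0) (a : ℝ) :
    {t : ℝ | Real.cos (a + t) * A - Real.sin (a + t) * B = 0}.Countable := by
  rcases eq_empty_or_nonempty {t : ℝ | Real.cos (a + t) * A - Real.sin (a + t) * B = 0}
    with h | ⟨t₀, ht₀⟩
  · rw [h]; exact countable_empty
  have h0 : Real.cos (a + t₀) * A - Real.sin (a + t₀) * B = 0 := ht₀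
  refine (countable_sin_add_eq_zero (-t₀)).mono fun t ht => ?_
  have h1 : Real.cos (a + t) * A - Real.sin (a + t) * B = 0 := ht
  have h2 : Real.sin (-t₀ + t) * B = 0 := by
    rw [show -t₀ + t = (a + t) - (a + t₀) by ring, Real.sin_sub]
    linear_combination Real.cos (a + t) * h0 - Real.cos (a + t₀) * h1
  exact (mul_eq_zero.1 h2).resolve_right hB

/-- The planes `m_x = ± m_z` pull back to zero sets of products. The factors in `k_y` of this
identity and the next multiply to `cos 2k_y`. -/
theorem nvec_zero_sub_two (ε : ℤˣ) (k : E3) : nvec ε k 0 - nvec ε k 2 =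
    (Real.cos (k 1) - ((ε : ℤ) : ℝ) * Real.sin (k 1)) * Real.sin (k 0 - k 2) := by
  rw [nvec_apply_zero, nvec_apply_two, Real.sin_sub]
  ring

theorem nvec_zero_add_two (ε : ℤˣ) (k : E3) : nvec ε k 0 + nvec ε k 2 =
    (Real.cos (k 1) + ((ε : ℤ) : ℝ) * Real.sin (k 1)) * Real.sin (k 0 + k 2) := by
  rw [nvec_apply_zero, nvec_apply_two, Real.sin_add]
  ring

theorem volume_lam_eq_zero (ε : ℤˣ) : volume {k : E3 | lam ε k = 0 ∧
    Real.sin (k 1) * Real.sin (k 2) ≠ 0} = 0 := by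
  refine volume_eq_zero_of_countable_lines (MeasurableSet.inter ?_ (MeasurableSet.compl ?_))
    (EuclideanSpace.single 0 1) fun k => ?_
  · exact (isClosed_eq (continuous_lam ε) continuous_const).measurableSet
  · exact (isClosed_eq (f := fun k : E3 => Real.sin (k 1) * Real.sin (k 2)) (by fun_prop)
      continuous_const).measurableSet
  -- Lines in the `x` direction leave `k_y` and `k_z` fixed: either the whole line misses the set,
  -- or `λ` is a nontrivial combination of sine and cosine along it.
  · by_cases hB : Real.sin (k 1) * Real.sin (k 2) = 0
    · refine countable_empty.mono fun t ht => ?_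
      have := ht.2
      simp at this
      simp [this] at hB
    · have hB' : ((ε : ℤ) : ℝ) * (Real.sin (k 1) * Real.sin (k 2)) ≠ 0 :=
        mul_ne_zero (by intro h; have := sign_sq ε; simp [h] at this) hB
      refine (countable_trig_zeros (A := Real.cos (k 1) * Real.cos (k 2)) hB' (k 0)).mono
        fun t ht => ?_
      have h1 : lam ε (k + t • EuclideanSpace.single 0 1) = 0 := ht.1
      simp [lam] at h1
      change _ = _
      linear_combination h1

theorem volume_setOf_sin_eq_zero {f : E3 → ℝ} (hf : Continuous f) (v : E3)
    (hv : ∀ (k : E3) (t : ℝ), f (k + t • v) = f k + t) :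
    volume {k : E3 | Real.sin (f k) = 0} = 0 := by
  refine volume_eq_zero_of_countable_lines
    (isClosed_eq (Real.continuous_sin.comp hf) continuous_const).measurableSet v fun k => ?_
  refine (countable_sin_add_eq_zero (f k)).mono fun t ht => ?_
  change Real.sin (f k + t) = 0
  rw [← hv]
  exact ht

theorem volume_compl_regions (ε : ℤˣ) :
    volume {k : E3 | k ∈ firstZone ∧ ∀ i : Fin 4, toBrillouin k ∉ region ε i} = 0 := by
  have hsing : ∀ (a : Fin 3) (k : E3) (t : ℝ), (k + t • EuclideanSpace.single a 1 : E3) a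
      = k a + t := by intro a k t; simp
  have hcoord : ∀ a : Fin 3, volume {k : E3 | Real.sin (k a) = 0} = 0 := fun a =>
    volume_setOf_sin_eq_zero (f := fun k => k a) (by fun_prop) (EuclideanSpace.single a 1) (hsing a)
  have hcos : volume {k : E3 | Real.cos (2 * k 1) = 0} = 0 := by
    have : {k : E3 | Real.cos (2 * k 1) = 0} = {k : E3 | Real.sin (2 * k 1 + Real.pi / 2) = 0} := by
      simp only [Real.sin_add_pi_div_two]
    rw [this]
    -- The direction has length `1/2` so that `2 k_y` grows at unit rate.
    refine volume_setOf_sin_eq_zero (f := fun k => 2 * k 1 + Real.pi / 2) (by fun_prop)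
      (EuclideanSpace.single 1 (1 / 2)) fun k t => ?_
    simp
    ring
  have hsub : volume {k : E3 | Real.sin (k 0 - k 2) = 0} = 0 :=
    volume_setOf_sin_eq_zero (f := fun k => k 0 - k 2) (by fun_prop)
      (EuclideanSpace.single 0 1) fun k t => by simp; ring
  have hadd : volume {k : E3 | Real.sin (k 0 + k 2) = 0} = 0 :=
    volume_setOf_sin_eq_zero (f := fun k => k 0 + k 2) (by fun_prop)
      (EuclideanSpace.single 0 1) fun k t => by simp; ring
  refine measure_mono_null (fun k hk => ?_)
    (measure_union_null (volume_lam_eq_zero ε) (measure_union_null (hcoord 1)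
      (measure_union_null (hcoord 2) (measure_union_null hcos (measure_union_null hsub hadd)))))
  by_contra hnot
  simp only [mem_union, not_or] at hnot
  obtain ⟨h1, h2, h3, h4, h5, h6⟩ := hnot
  have hs : Real.sin (k 1) * Real.sin (k 2) ≠ 0 := mul_ne_zero h2 h3
  have hlam : lam ε k ≠ 0 := fun h => h1 ⟨h, hs⟩
  have hc : Real.cos (2 * k 1) ≠ 0 := h4
  -- `λ ≠ 0` is the same as `|n| < 1`, so no separate null set is needed for the unit sphere.
  have hU : nvec ε k ∈ ballU := by
    have := lam_sq_add_norm_sq ε k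
    have hpos : 0 < lam ε k ^ 2 := by positivity
    change ‖nvec ε k‖ < 1
    nlinarith [norm_nonneg (nvec ε k)]
  have he := sign_sq ε
  rw [Real.cos_two_mul'] at hc
  have hH : nvec ε k ∉ setH := by
    rintro ⟨-, h | h, -⟩
    · have h7 := nvec_zero_sub_two ε k
      rw [h, sub_self] at h7
      rcases mul_eq_zero.1 h7.symm with h8 | h8
      · refine hc ?_
        linear_combination (Real.cos (k 1) + ((ε : ℤ) : ℝ) * Real.sin (k 1)) * h8
          + Real.sin (k 1) ^ 2 * he
      · exact h5 h8
    · have h7 := nvec_zero_add_two ε k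
      rw [h, neg_add_cancel] at h7
      rcases mul_eq_zero.1 h7.symm with h8 | h8
      · refine hc ?_
        linear_combination (Real.cos (k 1) - ((ε : ℤ) : ℝ) * Real.sin (k 1)) * h8
          + Real.sin (k 1) ^ 2 * he
      · exact h6 h8
  rw [← Real.cos_two_mul'] at hc
  have hn : nvec ε k ∈ ballU \ setH := ⟨hU, hH⟩
  obtain ⟨i, hi⟩ : ∃ i : Fin 4, 0 < lamSign i * lam ε k ∧
      0 < cosSign i * Real.cos (2 * k 1) := by
    rcases lt_or_gt_of_ne hlam with hl | hl <;> rcases lt_or_gt_of_ne hc with hc | hc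
    · exact ⟨3, by simpa [lamSign, cosSign] using ⟨hl, hc⟩⟩
    · exact ⟨1, by simpa [lamSign, cosSign] using ⟨hl, hc⟩⟩
    · exact ⟨2, by simpa [lamSign, cosSign] using ⟨hl, hc⟩⟩
    · exact ⟨0, by simpa [lamSign, cosSign] using ⟨hl, hc⟩⟩
  exact hk.2 i (mem_region_mk.2 ⟨hi, hn⟩)

theorem jac_zero : jac 0 = ContinuousLinearMap.id ℝ E4 := by
  have h : Matrix.diagonal (reflSign 0) = 1 := by
    rw [← Matrix.diagonal_one]
    congr 1
    funext j
    fin_cases j <;> simp [reflSign]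
  rw [jac, h, map_one]
  rfl

end WeylWalk

end

theorem mainTheorem3 (ε : ℤˣ) :
    -- the Jacobians of `𝒩` and of `𝒟^(0)` at the origin are the identity
    HasFDerivAt mapN (ContinuousLinearMap.id ℝ E4) 0 ∧
    HasFDerivAt (fun x : E4 => mapD ε (covProj x)) (ContinuousLinearMap.id ℝ E4) 0 ∧
    (∀ i : Fin 4,
      -- `𝒟^(i)` is an analytic diffeomorphism from `Σ_i` onto the null mass shell
      IsAnalyticDiffeo covProj (id : E4 → E4) (mapD ε) (solutions ε i) nullShell ∧
      -- its Jacobian at the centre of `Σ_i`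
      covProj (0, kCenter ε i) ∈ solutions ε i ∧
      mapD ε (covProj (0, kCenter ε i)) = 0 ∧
      HasFDerivAt (fun x : E4 => mapD ε (covProj x)) (jac i) (0, kCenter ε i) ∧
      -- the maps `𝓛^(i)_L` are a representation of the Lorentz group on `Σ_i`
      (∃ ρ : LorentzGroup →* Equiv.Perm (solutions ε i),
        ∀ (L : LorentzGroup) (x : solutions ε i), (ρ L x : ℝ × Brillouin) = mapL ε i L x) ∧
      (∀ L : LorentzGroup,
        (∀ x ∈ solutions ε i, mapD ε (mapL ε i L x) = (L : E4 ≃L[ℝ] E4) (mapD ε x)) ∧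
        IsAnalyticDiffeo covProj covProj (mapL ε i L) (solutions ε i) (solutions ε i) ∧
        -- linear limit at small wave-vector
        ∃ F : E4 → E4, AnalyticAt ℝ F (0, kCenter ε i) ∧
          (∀ᶠ u in 𝓝 ((0, kCenter ε i) : E4),
            covProj u ∈ solutions ε i → mapL ε i L (covProj u) = covProj (F u)) ∧
          F (0, kCenter ε i) = (0, kCenter ε i) ∧
          HasFDerivAt F ((jac i).comp (((L : E4 ≃L[ℝ] E4) : E4 →L[ℝ] E4).comp (jac i)))
            (0, kCenter ε i))) ∧
    -- the regions cover the Brillouin zone up to a null set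
    volume {k : E3 | k ∈ firstZone ∧ ∀ i : Fin 4, toBrillouin k ∉ region ε i} = 0 := by
  refine ⟨?_, ?_, fun i => ⟨isAnalyticDiffeo_mapD ε i, kCenter_mem_solutions ε i,
    mapD_kCenter ε i, hasFDerivAt_mapD_kCenter ε i, ⟨lorentzRep ε i, lorentzRep_apply ε i⟩,
    fun L => ⟨fun x hx => mapD_mapL L hx, isAnalyticDiffeo_mapL ε i L, exists_mapL_lift ε i L⟩⟩,
    volume_compl_regions ε⟩
  · rw [← derivN_zero]
    exact hasFDerivAt_mapN (x := 0) zero_mem_ballU_diff_setH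
  · rw [← jac_zero]
    exact hasFDerivAt_mapD_kCenter ε 0
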